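/- Let $M$ be a compact connected boundaryless smooth ($C^\infty$, Hausdorff) manifold of dimension $3$ with a smooth Riemannian metric $g$, let $m$ be the normalized Lebesgue measure of $M$ (the Riemannian volume of $g$ divided by its total mass), and let $\operatorname{div}$ be the divergence with respect to $g$. Let $X$ be a $C^1$ vector field on $M$ with flow $X_t$, $t\in\mathbb{R}$. For $p\in M$ and $t>0$ let $$\mu_{p,t}=\frac1t\int_0^t\delta_{X_s(p)}\,ds,$$ and let $\mathcal{M}(p,X)$ be the set of Borel probability measures $\mu$ on $M$ such that $\mu=\lim_{k\to\infty}\mu_{p,t_k}$, in the weak topology, for some sequence $t_k\to\infty$ of positive times. Then there is a Borel set $L_X\subset M$ with $m(L_X)=1$ such that for every $x\in L_X$ and every $\mu\in\mathcal{M}(x,X)$ the function $\operatorname{div}X$ is $\mu$-integrable and $$\int \operatorname{div}X\,d\mu\le 0 .$$ -/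

import Mathlib

open Set Filter Topology MeasureTheory Manifold
open scoped ContDiff ENNReal

noncomputable section

namespace FlowDiv

variable {n : ℕ} {M : Type*} [TopologicalSpace M] [ChartedSpace (EuclideanSpace ℝ (Fin n)) M]

/-! ### The flow, its empirical measures and their limits -/

/-- A vector field on the `n`-dimensional boundaryless manifold `M`. -/
abbrev VField (n : ℕ) (M : Type*) [TopologicalSpace M]
    [ChartedSpace (EuclideanSpace ℝ (Fin n)) M] : Type _ :=
  (x : M) → TangentSpace (𝓡 n) x

/-- The vector field `X` is of class `C^1`, as a section of the tangent bundle. -/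
def IsC1 [IsManifold (𝓡 n) 1 M] (X : VField n M) : Prop :=
  ContMDiff (𝓡 n) (𝓡 n).tangent 1 (fun x => (⟨x, X x⟩ : TangentBundle (𝓡 n) M))

open Classical in
/-- The flow `X_t(x)` of the vector field `X`: the curve `t ↦ flow X t x` is the integral curve of
`X`, defined on all of `ℝ`, that starts at `x`. For a `C^1` vector field on a compact Hausdorff
manifold this curve exists and is unique. If there were no such curve, the value would be `x`. -/
def flow (X : VField n M) (t : ℝ) (x : M) : M :=
  if h : ∃ γ : ℝ → M, γ 0 = x ∧ IsMIntegralCurve (I := 𝓡 n) γ X then h.choose t else x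

theorem continuous_flow (X : VField n M) (x : M) : Continuous (fun t => flow X t x) := by
  unfold flow
  split_ifs with h
  · exact continuous_iff_continuousAt.2 fun t => (h.choose_spec.2 t).continuousAt
  · exact continuous_const

/-- The empirical measure `(1/t) ∫_0^t δ_{X_s(p)} ds`, for `t > 0`: the image of the normalized
Lebesgue measure of `[0, t]` under `s ↦ X_s(p)`. -/
def empiricalMeasure [MeasurableSpace M] [BorelSpace M] (X : VField n M) (p : M) (t : ℝ)
    (ht : 0 < t) : ProbabilityMeasure M :=
  ⟨(ENNReal.ofReal t)⁻¹ • (volume.restrict (Icc 0 t)).map (fun s => flow X s p), by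
    constructor
    rw [Measure.smul_apply, Measure.map_apply (continuous_flow X p).measurable MeasurableSet.univ]
    simp [ENNReal.inv_mul_cancel, ht]⟩

/-- `𝓜(p, X)`: the limits, in the weak topology of Borel probability measures, of the empirical
measures of `p` along sequences of times that tend to infinity. -/
def limitMeasures [MeasurableSpace M] [BorelSpace M] (X : VField n M) (p : M) :
    Set (ProbabilityMeasure M) :=
  {μ | ∃ (t : ℕ → ℝ) (ht : ∀ k, 0 < t k), Tendsto t atTop atTop ∧
    Tendsto (fun k => empiricalMeasure X p (t k) (ht k)) atTop (𝓝 μ)}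

/-! ### Riemannian volume and divergence -/

/-- A smooth Riemannian metric on `M`. -/
abbrev Metric (n : ℕ) (M : Type*) [TopologicalSpace M]
    [ChartedSpace (EuclideanSpace ℝ (Fin n)) M] [IsManifold (𝓡 n) ∞ M] : Type _ :=
  Bundle.ContMDiffRiemannianMetric (𝓡 n) ∞ (EuclideanSpace ℝ (Fin n))
    (fun x : M => TangentSpace (𝓡 n) x)

/-- The coordinate vector field `∂/∂y_i` of the chart `φ`, at the point with coordinates `y`. -/
def coordVector (φ : OpenPartialHomeomorph M (EuclideanSpace ℝ (Fin n)))
    (y : EuclideanSpace ℝ (Fin n)) (i : Fin n) : TangentSpace (𝓡 n) (φ.symm y) :=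
  mfderiv (𝓡 n) (𝓡 n) φ.symm y (EuclideanSpace.single i (1 : ℝ))

/-- The matrix `(g_{ij})` of the metric in the chart `φ`. -/
def gram [IsManifold (𝓡 n) ∞ M] (g : Metric n M)
    (φ : OpenPartialHomeomorph M (EuclideanSpace ℝ (Fin n)))
    (y : EuclideanSpace ℝ (Fin n)) : Matrix (Fin n) (Fin n) ℝ :=
  Matrix.of fun i j => g.inner (φ.symm y) (coordVector φ y i) (coordVector φ y j)

/-- The volume density `√(det (g_{ij}))` in the chart `φ`. -/
def density [IsManifold (𝓡 n) ∞ M] (g : Metric n M)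
    (φ : OpenPartialHomeomorph M (EuclideanSpace ℝ (Fin n)))
    (y : EuclideanSpace ℝ (Fin n)) : ℝ :=
  √(gram g φ y).det

/-- The measure `√(det (g_{ij})) dy_1 ⋯ dy_n` of the chart `φ`, carried over to `M`, where it is
concentrated on the domain of `φ`. -/
def chartVolume [IsManifold (𝓡 n) ∞ M] [MeasurableSpace M] (g : Metric n M)
    (φ : OpenPartialHomeomorph M (EuclideanSpace ℝ (Fin n))) : Measure M :=
  ((volume.restrict φ.target).withDensity (fun y => ENNReal.ofReal (density g φ y))).map φ.symm

/-- The Riemannian volume: the measures of the charts agree on the overlaps, and their supremum is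
the measure whose restriction to the domain of each chart `φ` is `chartVolume g φ`. -/
def riemannianVolume [IsManifold (𝓡 n) ∞ M] [MeasurableSpace M] (g : Metric n M) : Measure M :=
  ⨆ φ ∈ atlas (EuclideanSpace ℝ (Fin n)) M, chartVolume g φ

/-- The normalized Lebesgue measure of the Riemannian manifold `(M, g)`. -/
def normalizedVolume [IsManifold (𝓡 n) ∞ M] [MeasurableSpace M] (g : Metric n M) : Measure M :=
  (riemannianVolume g univ)⁻¹ • riemannianVolume g

/-- The coordinates `(X^1, …, X^n)` of the vector field `X` in the chart `φ`. -/
def coordField (X : VField n M) (φ : OpenPartialHomeomorph M (EuclideanSpace ℝ (Fin n)))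
    (y : EuclideanSpace ℝ (Fin n)) : EuclideanSpace ℝ (Fin n) :=
  mfderiv (𝓡 n) (𝓡 n) φ (φ.symm y) (X (φ.symm y))

/-- The divergence of `X` at `p` with respect to the Riemannian metric `g`, that is
`(1/ρ) ∑_i ∂(ρ X^i)/∂y_i` with `ρ = √(det (g_{ij}))`, in the preferred chart at `p`. -/
def divergence [IsManifold (𝓡 n) ∞ M] (g : Metric n M) (X : VField n M) (p : M) : ℝ :=
  let φ := chartAt (EuclideanSpace ℝ (Fin n)) p
  (density g φ (φ p))⁻¹ *
    ∑ i : Fin n, fderiv ℝ (fun y => density g φ y * coordField X φ y i) (φ p)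
      (EuclideanSpace.single i (1 : ℝ))

end FlowDiv

end

noncomputable section

namespace FlowDiv

section Euclidean

variable {E : Type*} [NormedAddCommGroup E] [NormedSpace ℝ E]

/-! ### Jacobian estimates for short time flows in a vector space -/

/-! Since the divergence is the logarithmic rate of change of volume, the function `exp (∫_0^t div X
(X_s x) ds)` is the Jacobian of the flow at time `t`, and its integral over `M` is the total volume
for every `t`. By Markov, the points where `∫_0^t div X ≥ δ t` have volume at most `e^{-δ t} vol M`.
This is summable along a discrete sequence of times, so Borel-Cantelli gives that at almost every
point the time averages of `div X` have upper limit at most `0`. Weak limits of the empirical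
measures inherit the bound because `div X` is continuous on a compact space. Neither an invariant
volume nor an ergodic theorem enters.

The exact Jacobian formula is replaced by a short time version with error `ε`. In a chart, the time
`h` map is uniformly close to `1 + h • A` in the Lipschitz sense, hence differentiable almost
everywhere, and its Jacobian relative to the density lies between `exp (h (div ± ε))`
(`exists_abs_log_jacobian_sub_le`, `exists_volume_image_flow_bounds`). No differentiability of the
flow in the initial point has to be proved.

Compactness makes this uniform: pushing `exp (h (div - ε))` times the volume forward by the time `h`
map gives a measure below the volume (`exists_setLIntegral_exp_divergence_le`). Iterating bounds the
exponential moments of Birkhoff sums (`lintegral_exp_birkhoffSum_le`,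
`ae_eventually_birkhoffSum_le`). For small `h` these sums approximate the time integrals, and `ε`
tends to `0` through a countable sequence. -/

theorem hasFDerivAt_det_one_add [FiniteDimensional ℝ E] :
    HasFDerivAt (fun H : E →L[ℝ] E => (1 + H).det)
      (LinearMap.toContinuousLinearMap
        ((LinearMap.trace ℝ E).comp (ContinuousLinearMap.coeLM ℝ : (E →L[ℝ] E) →ₗ[ℝ] _))) 0 := by
  classical
  let b := Module.finBasis ℝ E
  have hdet : ∀ H : E →L[ℝ] E, (1 + H).det =
      (1 + LinearMap.toMatrix b b (H : E →ₗ[ℝ] E)).det := by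
    intro H
    rw [ContinuousLinearMap.det, ← LinearMap.det_toMatrix b]
    congr 1
    rw [ContinuousLinearMap.toLinearMap_add, map_add]
    congr 1
    exact LinearMap.toMatrix_one b
  have hdiff : DifferentiableAt ℝ (fun H : E →L[ℝ] E => (1 + H).det) 0 := by
    simp only [hdet, Matrix.det_apply]
    refine DifferentiableAt.fun_sum fun σ _ => DifferentiableAt.const_smul ?_ _
    refine (HasFDerivAt.finsetProd (fun i _ =>
      DifferentiableAt.hasFDerivAt ?_)).differentiableAt
    simp only [Matrix.add_apply]
    refine (differentiableAt_const _).add ?_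
    simp only [LinearMap.toMatrix_apply]
    let l : (E →L[ℝ] E) →ₗ[ℝ] ℝ :=
      { toFun := fun H => b.repr (H (b i)) (σ i)
        map_add' := by intros; simp
        map_smul' := by intros; simp }
    exact (LinearMap.toContinuousLinearMap l).differentiableAt
  refine hdiff.hasFDerivAt.congr_fderiv ?_
  ext H
  have h1 : HasDerivAt (fun t : ℝ => (1 + t • H).det)
      (fderiv ℝ (fun H : E →L[ℝ] E => (1 + H).det) 0 H) 0 := by
    have h2 : HasDerivAt (fun t : ℝ => t • H) ((1 : ℝ) • H) 0 := (hasDerivAt_id 0).smul_const H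
    have h3 : HasFDerivAt (fun H : E →L[ℝ] E => (1 + H).det)
      (fderiv ℝ (fun H : E →L[ℝ] E => (1 + H).det) 0) ((0 : ℝ) • H) := by
      simpa using hdiff.hasFDerivAt
    have h4 := h3.comp_hasDerivAt (0 : ℝ) h2
    rw [one_smul] at h4
    exact h4
  set M := LinearMap.toMatrix b b (H : E →ₗ[ℝ] E) with hM
  -- Along the line through `H` the determinant is a polynomial in `t`, whose derivative at `0` is
  -- the trace.
  have h4 : (fun t : ℝ => (1 + t • H).det) = fun t : ℝ =>
      ((1 + (Polynomial.X : Polynomial ℝ) • M.map Polynomial.C).det).eval t := by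
    funext t
    rw [hdet]
    rw [← Polynomial.coe_evalRingHom, RingHom.map_det]
    congr 1
    ext i j
    simp [hM, Matrix.one_apply, apply_ite, mul_comm t]
  rw [h4] at h1
  have h5 := h1.unique (Polynomial.hasDerivAt _ _)
  rw [h5, Matrix.derivative_det_one_add_X_smul]
  simp [hM, LinearMap.trace_eq_matrix_trace ℝ b]

/-- The derivative of `log det` at the identity is the trace; this is its little-o statement with an
explicit radius. -/
theorem exists_abs_log_det_one_add_sub_trace_le [FiniteDimensional ℝ E] {ε : ℝ} (hε : 0 < ε) :
    ∃ δ > 0, ∀ H : E →L[ℝ] E, ‖H‖ ≤ δ → 0 < (1 + H).det ∧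
      |Real.log (1 + H).det - LinearMap.trace ℝ E H| ≤ ε * ‖H‖ := by
  have h0 := hasFDerivAt_det_one_add (E := E)
  have hone : (1 + (0 : E →L[ℝ] E)).det = 1 := by
    simp [ContinuousLinearMap.det]
  have hpos : ∀ᶠ H in 𝓝 (0 : E →L[ℝ] E), 0 < (1 + H).det :=
    h0.continuousAt.eventually_const_lt (one_pos.trans_eq hone.symm)
  have h1 := (h0.log (by rw [hone]; exact one_ne_zero)).isLittleO.def hε
  obtain ⟨δ, hδ, h⟩ := Metric.eventually_nhds_iff_ball.1 (hpos.and h1)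
  refine ⟨δ / 2, half_pos hδ, fun H hH => ?_⟩
  obtain ⟨ha, hb⟩ := h H (by rw [mem_ball_zero_iff]; linarith)
  refine ⟨ha, ?_⟩
  have hone' : (1 : E →L[ℝ] E).det = 1 := by simp [ContinuousLinearMap.det]
  simpa [hone'] using hb

/-- Mean value inequality for `u s - s • a`. -/
theorem norm_sub_sub_le_of_hasDerivWithinAt {u : ℝ → E} {u' : ℝ → E} {a : E} {h C : ℝ} (hh : 0 ≤ h)
    (hu : ∀ s ∈ Icc 0 h, HasDerivWithinAt u (u' s) (Icc 0 h) s)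
    (hC : ∀ s ∈ Icc 0 h, ‖u' s - a‖ ≤ C) : ‖u h - u 0 - h • a‖ ≤ h * C := by
  have := (convex_Icc (0 : ℝ) h).norm_image_sub_le_of_norm_hasDerivWithin_le
    (f := fun s => u s - s • a) (f' := fun s => u' s - (1 : ℝ) • a) (C := C)
    (fun s hs => (hu s hs).sub ((hasDerivWithinAt_id s _).smul_const a))
    (fun s hs => by simpa using hC s hs) (left_mem_Icc.2 hh) (right_mem_Icc.2 hh)
  simp only [zero_smul, sub_zero, Real.norm_of_nonneg hh] at this
  rw [mul_comm]
  convert this using 2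
  abel

/-- Two trajectories of a vector field which is close to a linear one separate, in a short time,
almost as those of the linear one. -/
theorem norm_trajectories_sub_sub_le {Y : E → E} {A : E →L[ℝ] E} {W : Set E} {c h L : ℝ}
    (hc : 0 ≤ c) (hL : ‖A‖ + c ≤ L) (hh : 0 ≤ h) (hLh : L * h ≤ 1)
    (hY : ∀ x ∈ W, ∀ y ∈ W, ‖Y x - Y y - A (x - y)‖ ≤ c * ‖x - y‖) {u v : ℝ → E}
    (hu : ∀ s ∈ Icc 0 h, HasDerivWithinAt u (Y (u s)) (Icc 0 h) s) (huW : ∀ s ∈ Icc 0 h, u s ∈ W)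
    (hv : ∀ s ∈ Icc 0 h, HasDerivWithinAt v (Y (v s)) (Icc 0 h) s)
    (hvW : ∀ s ∈ Icc 0 h, v s ∈ W) :
    ‖(u h - v h) - (u 0 - v 0) - h • A (u 0 - v 0)‖
      ≤ h * ((3 * c + 3 * L ^ 2 * h) * ‖u 0 - v 0‖) := by
  have hL0 : 0 ≤ L := le_trans (by positivity) hL
  have hlip : ∀ x ∈ W, ∀ y ∈ W, ‖Y x - Y y‖ ≤ L * ‖x - y‖ := by
    intro x hx y hy
    calc ‖Y x - Y y‖ = ‖(Y x - Y y - A (x - y)) + A (x - y)‖ := by rw [sub_add_cancel]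
      _ ≤ c * ‖x - y‖ + ‖A‖ * ‖x - y‖ :=
        (norm_add_le _ _).trans (add_le_add (hY x hx y hy) (A.le_opNorm _))
      _ = (‖A‖ + c) * ‖x - y‖ := by ring
      _ ≤ L * ‖x - y‖ := by gcongr
  have hLip : LipschitzOnWith ⟨L, hL0⟩ Y W := LipschitzOnWith.of_dist_le_mul fun x hx y hy => by
    rw [dist_eq_norm, dist_eq_norm]; exact hlip x hx y hy
  have hright : ∀ w : ℝ → E, (∀ s ∈ Icc 0 h, HasDerivWithinAt w (Y (w s)) (Icc 0 h) s) →
      ∀ s ∈ Ico 0 h, HasDerivWithinAt w (Y (w s)) (Ici s) s := fun w hw s hs =>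
    (hw s ⟨hs.1, hs.2.le⟩).mono_of_mem_nhdsWithin
      (mem_of_superset (Icc_mem_nhdsGE hs.2) (Icc_subset_Icc_left hs.1))
  -- Grönwall, with growth factor `exp (L * s) ≤ e < 3` because `L * h ≤ 1`.
  have hw : ∀ s ∈ Icc 0 h, ‖u s - v s‖ ≤ 3 * ‖u 0 - v 0‖ := by
    intro s hs
    have h1 := dist_le_of_trajectories_ODE_of_mem (v := fun _ => Y) (s := fun _ => W)
      (K := ⟨L, hL0⟩) (fun t _ => hLip) (fun t ht => (hu t ht).continuousWithinAt) (hright u hu)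
      (fun t ht => huW t ⟨ht.1, ht.2.le⟩)
      (fun t ht => (hv t ht).continuousWithinAt) (hright v hv)
      (fun t ht => hvW t ⟨ht.1, ht.2.le⟩) le_rfl s hs
    rw [dist_eq_norm, dist_eq_norm, sub_zero] at h1
    refine h1.trans ?_
    rw [mul_comm]
    gcongr
    calc Real.exp (L * s) ≤ Real.exp 1 := Real.exp_le_exp.2
          ((mul_le_mul_of_nonneg_left hs.2 hL0).trans hLh)
      _ ≤ 3 := Real.exp_one_lt_three.le
  have hsub : ∀ s ∈ Icc 0 h,
      HasDerivWithinAt (fun s => u s - v s) (Y (u s) - Y (v s)) (Icc 0 h) s :=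
    fun s hs => (hu s hs).sub (hv s hs)
  have hw0 : ∀ s ∈ Icc 0 h, ‖(u s - v s) - (u 0 - v 0)‖ ≤ h * (3 * L * ‖u 0 - v 0‖) := by
    intro s hs
    have hI : Icc 0 s ⊆ Icc 0 h := Icc_subset_Icc_right hs.2
    have := norm_sub_sub_le_of_hasDerivWithinAt (u := fun s => u s - v s) (a := 0)
      (C := 3 * L * ‖u 0 - v 0‖) hs.1
      (fun t ht => (hsub t (hI ht)).mono hI) (fun t ht => by
        rw [sub_zero]
        calc _ ≤ L * ‖u t - v t‖ := hlip _ (huW t (hI ht)) _ (hvW t (hI ht))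
          _ ≤ L * (3 * ‖u 0 - v 0‖) := by gcongr; exact hw t (hI ht)
          _ = _ := by ring)
    rw [smul_zero, sub_zero] at this
    exact this.trans (mul_le_mul_of_nonneg_right hs.2 (by positivity))
  -- The velocity of `u - v` differs from `A (u 0 - v 0)` by the linearization error of `Y` and by
  -- `A` applied to the drift of `u - v` up to time `s`.
  refine norm_sub_sub_le_of_hasDerivWithinAt hh hsub fun s hs => ?_
  calc ‖Y (u s) - Y (v s) - A (u 0 - v 0)‖
      = ‖(Y (u s) - Y (v s) - A (u s - v s)) + A ((u s - v s) - (u 0 - v 0))‖ := by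
        rw [map_sub A (u s - v s)]; congr 1; abel
    _ ≤ c * (3 * ‖u 0 - v 0‖) + L * (h * (3 * L * ‖u 0 - v 0‖)) := by
        refine (norm_add_le _ _).trans (add_le_add ?_ ?_)
        · exact (hY _ (huW s hs) _ (hvW s hs)).trans (by gcongr; exact hw s hs)
        · refine (A.le_opNorm _).trans ?_
          gcongr
          · linarith
          · exact hw0 s hs
    _ = (3 * c + 3 * L ^ 2 * h) * ‖u 0 - v 0‖ := by ring

end Euclidean

section EuclideanJacobian

variable {E : Type*} [NormedAddCommGroup E] [NormedSpace ℝ E] [FiniteDimensional ℝ E]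

theorem exists_trace_le : ∃ T > 0, ∀ H : E →L[ℝ] E, |LinearMap.trace ℝ E H| ≤ T * ‖H‖ := by
  obtain ⟨T, h0, h⟩ := (LinearMap.toContinuousLinearMap
    ((LinearMap.trace ℝ E).comp (ContinuousLinearMap.coeLM ℝ : (E →L[ℝ] E) →ₗ[ℝ] _))).bound
  exact ⟨T, h0, fun H => by simpa using h H⟩

/-- For a flow of `Y` near `y₀`, the logarithmic change of `ρ`-volume in time `h` is nearly
`h (tr DY + Dρ Y / ρ)(y₀)`. -/
theorem exists_abs_log_jacobian_sub_le {Y : E → E} {A : E →L[ℝ] E} {y₀ : E}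
    (hY : HasStrictFDerivAt Y A y₀) {ρ : E → ℝ} {ρ' : E →L[ℝ] ℝ} (hρ : HasStrictFDerivAt ρ ρ' y₀)
    (hρ0 : 0 < ρ y₀) {ε : ℝ} (hε : 0 < ε) :
    ∃ R > 0, ∃ h₀ > 0, ∀ h ∈ Ioc 0 h₀, ∀ (U : Set E) (f : E → E), IsOpen U →
      (∀ y ∈ U, ∃ u : ℝ → E, u 0 = y ∧ u h = f y ∧ ∀ s ∈ Icc 0 h,
        HasDerivWithinAt u (Y (u s)) (Icc 0 h) s ∧ u s ∈ Metric.ball y₀ R) →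
      (∃ K, LipschitzOnWith K f U) ∧ ∀ y ∈ U, 0 < ρ y ∧ 0 < ρ (f y) ∧
        (DifferentiableAt ℝ f y → 0 < (fderiv ℝ f y).det ∧
          |Real.log (ρ (f y)) - Real.log (ρ y) + Real.log (fderiv ℝ f y).det
            - h * ((ρ y₀)⁻¹ * ρ' (Y y₀) + LinearMap.trace ℝ E A)| ≤ h * ε) := by
  obtain ⟨T, hT0, hT⟩ := exists_trace_le (E := E)
  set l : E →L[ℝ] ℝ := (ρ y₀)⁻¹ • ρ' with hl
  have hlog : HasStrictFDerivAt (fun y => Real.log (ρ y)) l y₀ := hρ.log hρ0.ne'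
  set M := ‖A‖ + 1 with hM
  have hM1 : 1 ≤ M := by simp [hM]
  set V := ‖Y y₀‖ + 1 with hV
  have hV1 : 1 ≤ V := by simp [hV]
  -- `Q` dominates the sum of the coefficients of `h * c` in the four errors `a1`-`a4` below, so `c
  -- * Q ≤ ε` suffices.
  set Q := V + ‖l‖ + M + 4 * T + 1 with hQ
  have hQ0 : 0 < Q := by positivity
  obtain ⟨c, hc0, hc4, hcQ⟩ : ∃ c > 0, c ≤ 1 / 4 ∧ c * Q ≤ ε :=
    ⟨min (1 / 4) (ε / Q), by positivity, min_le_left _ _,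
      (mul_le_mul_of_nonneg_right (min_le_right _ _) hQ0.le).trans_eq (div_mul_cancel₀ _ hQ0.ne')⟩
  obtain ⟨δ, hδ0, hδ⟩ := exists_abs_log_det_one_add_sub_trace_le (E := E) hc0
  have e1 := hY.isLittleO.def hc0
  have e2 := hlog.isLittleO.def hc0
  have e3 : ∀ᶠ y in 𝓝 y₀, ‖Y y - Y y₀‖ < c := by
    have : Tendsto (fun y => ‖Y y - Y y₀‖) (𝓝 y₀) (𝓝 0) := by
      simpa using (hY.continuousAt.sub (continuousAt_const (y := Y y₀))).norm.tendsto
    exact this.eventually_lt_const hc0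
  have e4 : ∀ᶠ y in 𝓝 y₀, 0 < ρ y := hρ.continuousAt.eventually_const_lt hρ0
  have e5 := (e1.and e2)
  rw [nhds_prod_eq] at e5
  obtain ⟨p, hp, q, hq, hpq⟩ := eventually_prod_iff.1 e5
  obtain ⟨R, hR0, hR⟩ := Metric.eventually_nhds_iff_ball.1 ((hp.and hq).and (e3.and e4))
  -- The three bounds on `h` make the quadratic term `3 * M ^ 2 * h` at most `c`, allow the Grönwall
  -- estimate, and bring `fderiv ℝ f y - 1` within the radius `δ` of the `log det` estimate.
  refine ⟨R, hR0, min (c / (3 * M ^ 2)) (min (1 / M) (δ / M)), by positivity, ?_⟩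
  intro h ⟨hh0, hh⟩ U f hU hcurve
  have hh1 : 3 * M ^ 2 * h ≤ c := by
    have := (le_div_iff₀ (by positivity)).1 (hh.trans (min_le_left _ _))
    linarith
  have hh2 : M * h ≤ 1 := by
    have := (le_div_iff₀ (by positivity)).1
      (hh.trans ((min_le_right _ _).trans (min_le_left _ _)))
    linarith
  have hh3 : h * M ≤ δ := (le_div_iff₀ (by positivity)).1
    (hh.trans ((min_le_right _ _).trans (min_le_right _ _)))
  set B := Metric.ball y₀ R with hB
  have hYB : ∀ x ∈ B, ∀ y ∈ B, ‖Y x - Y y - A (x - y)‖ ≤ c * ‖x - y‖ :=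
    fun x hx y hy => (hpq (hR x hx).1.1 (hR y hy).1.2).1
  have hlB : ∀ x ∈ B, ∀ y ∈ B,
      |Real.log (ρ x) - Real.log (ρ y) - l (x - y)| ≤ c * ‖x - y‖ :=
    fun x hx y hy => (hpq (hR x hx).1.1 (hR y hy).1.2).2
  have hmem : ∀ y ∈ U, y ∈ B ∧ f y ∈ B ∧ ‖f y - y - h • Y y₀‖ ≤ h * c := by
    intro y hy
    obtain ⟨u, h1, h2, h3⟩ := hcurve y hy
    refine ⟨h1 ▸ (h3 0 ⟨le_rfl, hh0.le⟩).2, h2 ▸ (h3 h ⟨hh0.le, le_rfl⟩).2, ?_⟩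
    rw [← h2, ← h1]
    exact norm_sub_sub_le_of_hasDerivWithinAt hh0.le (fun s hs => (h3 s hs).1)
      fun s hs => (hR _ (h3 s hs).2).2.1.le
  have happ : ∀ x ∈ U, ∀ y ∈ U,
      ‖(f x - f y) - (x - y) - h • A (x - y)‖ ≤ h * (4 * c) * ‖x - y‖ := by
    intro x hx y hy
    obtain ⟨u, h1, h2, h3⟩ := hcurve x hx
    obtain ⟨v, k1, k2, k3⟩ := hcurve y hy
    have := norm_trajectories_sub_sub_le (L := M) hc0.le (by linarith) hh0.le hh2 hYB
      (fun s hs => (h3 s hs).1) (fun s hs => (h3 s hs).2) (fun s hs => (k3 s hs).1)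
      (fun s hs => (k3 s hs).2)
    rw [h1, h2, k1, k2] at this
    refine this.trans ?_
    rw [← mul_assoc]
    gcongr
    linarith
  have hLip : LipschitzOnWith ⟨h * (4 * c), by positivity⟩ (fun x => f x - (1 + h • A) x) U := by
    refine LipschitzOnWith.of_dist_le_mul fun x hx y hy => ?_
    rw [dist_eq_norm, dist_eq_norm]
    refine le_of_eq_of_le (congrArg _ ?_) (happ x hx y hy)
    simp only [add_apply, one_apply_eq_self, smul_apply, map_sub, smul_sub]
    abel
  refine ⟨⟨_, by
    simpa using hLip.add ((1 + h • A : E →L[ℝ] E).lipschitz.lipschitzOnWith (s := U))⟩, ?_⟩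
  intro y hy
  obtain ⟨hyB, hfB, hd⟩ := hmem y hy
  refine ⟨(hR _ hyB).2.2, (hR _ hfB).2.2, fun hdiff => ?_⟩
  -- A Lipschitz constant of `f - (1 + h • A)` bounds its derivative wherever that derivative
  -- exists.
  have hD : ‖fderiv ℝ f y - (1 + h • A)‖ ≤ h * (4 * c) :=
    (hdiff.hasFDerivAt.sub (1 + h • A : E →L[ℝ] E).hasFDerivAt).le_of_lipschitzOn
      (hU.mem_nhds hy) hLip
  set H := fderiv ℝ f y - 1 with hH
  have hHA : ‖H - h • A‖ ≤ h * (4 * c) := by rwa [hH, sub_sub]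
  have hHM : ‖H‖ ≤ h * M := by
    calc ‖H‖ = ‖(H - h • A) + h • A‖ := by rw [sub_add_cancel]
      _ ≤ h * (4 * c) + h * ‖A‖ := (norm_add_le _ _).trans (add_le_add hHA (by
          rw [norm_smul, Real.norm_of_nonneg hh0.le]))
      _ ≤ h * 1 + h * ‖A‖ := by gcongr; linarith
      _ = h * M := by rw [hM]; ring
  obtain ⟨hdet, hdet'⟩ := hδ H (hHM.trans hh3)
  rw [hH, add_sub_cancel] at hdet
  refine ⟨hdet, ?_⟩
  have a1 : |Real.log (fderiv ℝ f y).det - LinearMap.trace ℝ E H| ≤ c * (h * M) := by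
    have : (1 : E →L[ℝ] E) + H = fderiv ℝ f y := by rw [hH, add_sub_cancel]
    rw [this] at hdet'
    exact hdet'.trans (by gcongr)
  have a2 : |LinearMap.trace ℝ E H - h * LinearMap.trace ℝ E A| ≤ T * (h * (4 * c)) := by
    have := (hT (H - h • A)).trans (mul_le_mul_of_nonneg_left hHA hT0.le)
    simpa using this
  have a0 : ‖f y - y‖ ≤ h * V := by
    calc ‖f y - y‖ = ‖(f y - y - h • Y y₀) + h • Y y₀‖ := by rw [sub_add_cancel]
      _ ≤ h * c + h * ‖Y y₀‖ := (norm_add_le _ _).trans (add_le_add hd (by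
          rw [norm_smul, Real.norm_of_nonneg hh0.le]))
      _ ≤ h * 1 + h * ‖Y y₀‖ := by gcongr; linarith
      _ = h * V := by rw [hV]; ring
  have a3 : |Real.log (ρ (f y)) - Real.log (ρ y) - l (f y - y)| ≤ c * (h * V) :=
    (hlB _ hfB _ hyB).trans (by gcongr)
  have a4 : |l (f y - y) - h * l (Y y₀)| ≤ ‖l‖ * (h * c) := by
    have := (l.le_opNorm (f y - y - h • Y y₀)).trans
      (mul_le_mul_of_nonneg_left hd (norm_nonneg l))
    rwa [map_sub, map_smul, smul_eq_mul, Real.norm_eq_abs] at this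
  have hlY : (ρ y₀)⁻¹ * ρ' (Y y₀) = l (Y y₀) := by simp [hl]
  rw [hlY]
  have hsum : c * (h * M) + T * (h * (4 * c)) + c * (h * V) + ‖l‖ * (h * c) ≤ h * ε := by
    calc _ = h * (c * (V + ‖l‖ + M + 4 * T)) := by ring
      _ ≤ h * (c * Q) := by gcongr; rw [hQ]; linarith
      _ ≤ h * ε := by gcongr
  rw [abs_le] at a1 a2 a3 a4 ⊢
  constructor <;> linarith [a1.1, a1.2, a2.1, a2.2, a3.1, a3.2, a4.1, a4.2]

end EuclideanJacobian

section EuclideanMeasure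

variable {E : Type*} [NormedAddCommGroup E] [NormedSpace ℝ E] [FiniteDimensional ℝ E]
  [MeasurableSpace E] [BorelSpace E] {μ : Measure E} [μ.IsAddHaarMeasure]

/-! ### Distortion of measures by short time flows in a vector space -/

/-- Haar measure is proportional to the Hausdorff measure of full dimension, which a Lipschitz map
multiplies by at most a constant. -/
theorem measure_image_eq_zero_of_lipschitzOnWith {K : NNReal} {f : E → E} {s : Set E}
    (hf : LipschitzOnWith K f s) (hs : μ s = 0) : μ (f '' s) = 0 := by
  let ν : Measure E := Measure.hausdorffMeasure (Module.finrank ℝ E)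
  have h1 : μ = Measure.addHaarScalarFactor μ ν • ν := Measure.isAddLeftInvariant_eq_smul μ ν
  have h2 : ν = Measure.addHaarScalarFactor ν μ • μ := Measure.isAddLeftInvariant_eq_smul ν μ
  have h3 : ν s = 0 := by rw [h2, Measure.smul_apply, hs, smul_zero]
  have h4 : ν (f '' s) = 0 := by
    have := hf.hausdorffMeasure_image_le (d := Module.finrank ℝ E) (by positivity)
    change ν (f '' s) ≤ _ * ν s at this
    rwa [h3, mul_zero, nonpos_iff_eq_zero] at this
  rw [h1, Measure.smul_apply, h4, smul_zero]

/-- Change of variables for an injective Lipschitz map. -/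
theorem lintegral_image_of_lipschitzOnWith {K : NNReal} {f : E → E} {U S : Set E} (hU : IsOpen U)
    (hf : LipschitzOnWith K f U) (hinj : InjOn f U) (hS : MeasurableSet S) (hSU : S ⊆ U)
    (G : E → ℝ≥0∞) :
    ∫⁻ x in f '' S, G x ∂μ = ∫⁻ x in S, ENNReal.ofReal |(fderiv ℝ f x).det| * G (f x) ∂μ := by
  -- By Rademacher the non-differentiability points lie in a null set `T`. Both `T` and the image of
  -- `S ∩ T` can be discarded, leaving the differentiable change of variables.
  obtain ⟨T, hTm, hT, hT0⟩ : ∃ T, MeasurableSet T ∧ (∀ x ∈ U, x ∉ T → DifferentiableAt ℝ f x) ∧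
      μ T = 0 := by
    have h := hf.ae_differentiableWithinAt_of_mem (μ := μ)
    obtain ⟨T, h1, h2, h3⟩ := exists_measurable_superset_of_null (ae_iff.1 h)
    refine ⟨T, h2, fun x hx hxT => ?_, h3⟩
    by_contra hd
    exact hxT (h1 fun hh => hd ((hh hx).differentiableAt (hU.mem_nhds hx)))
  have h1 : ∫⁻ x in f '' S, G x ∂μ = ∫⁻ x in f '' (S \ T), G x ∂μ := by
    refine setLIntegral_congr (ae_eq_set.2 ⟨?_, ?_⟩)
    · refine measure_mono_null (t := f '' (S ∩ T)) ?_
        (measure_image_eq_zero_of_lipschitzOnWith (hf.mono (inter_subset_left.trans hSU))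
          (measure_mono_null inter_subset_right hT0))
      rintro _ ⟨⟨x, hx, rfl⟩, h2⟩
      exact ⟨x, ⟨hx, by_contra fun h => h2 ⟨x, ⟨hx, h⟩, rfl⟩⟩, rfl⟩
    · rw [sdiff_eq_empty.2 (image_mono sdiff_subset), measure_empty]
  have h2 : ∫⁻ x in S, ENNReal.ofReal |(fderiv ℝ f x).det| * G (f x) ∂μ
      = ∫⁻ x in S \ T, ENNReal.ofReal |(fderiv ℝ f x).det| * G (f x) ∂μ := by
    refine setLIntegral_congr (ae_eq_set.2 ⟨?_, ?_⟩)
    · exact measure_mono_null (fun x hx => by_contra fun h => hx.2 ⟨hx.1, h⟩) hT0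
    · rw [sdiff_eq_empty.2 sdiff_subset, measure_empty]
  rw [h1, h2]
  exact lintegral_image_eq_lintegral_abs_det_fderiv_mul μ (hS.diff hTm)
    (fun x hx => (hT x (hSU hx.1) hx.2).hasFDerivAt.hasFDerivWithinAt)
    (hinj.mono (sdiff_subset.trans hSU)) G

/-- The pointwise Jacobian bounds of `exists_abs_log_jacobian_sub_le`, exponentiated and integrated
by change of variables. -/
theorem exists_lintegral_image_flow_bounds {Y : E → E} {A : E →L[ℝ] E} {y₀ : E}
    (hY : HasStrictFDerivAt Y A y₀) {ρ : E → ℝ} {ρ' : E →L[ℝ] ℝ} (hρ : HasStrictFDerivAt ρ ρ' y₀)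
    (hρ0 : 0 < ρ y₀) {ε : ℝ} (hε : 0 < ε) :
    ∃ R > 0, ∃ h₀ > 0, ∀ h ∈ Ioc 0 h₀, ∀ (U : Set E) (f : E → E), IsOpen U →
      (∀ y ∈ U, ∃ u : ℝ → E, u 0 = y ∧ u h = f y ∧ ∀ s ∈ Icc 0 h,
        HasDerivWithinAt u (Y (u s)) (Icc 0 h) s ∧ u s ∈ Metric.ball y₀ R) →
      InjOn f U → ∀ S ⊆ U, MeasurableSet S →
        let d := (ρ y₀)⁻¹ * ρ' (Y y₀) + LinearMap.trace ℝ E A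
        ENNReal.ofReal (Real.exp (h * (d - ε))) * ∫⁻ y in S, ENNReal.ofReal (ρ y) ∂μ
          ≤ ∫⁻ y in f '' S, ENNReal.ofReal (ρ y) ∂μ ∧
        ∫⁻ y in f '' S, ENNReal.ofReal (ρ y) ∂μ
          ≤ ENNReal.ofReal (Real.exp (h * (d + ε))) * ∫⁻ y in S, ENNReal.ofReal (ρ y) ∂μ := by
  obtain ⟨R, hR, h₀, hh₀, H⟩ := exists_abs_log_jacobian_sub_le hY hρ hρ0 hε
  refine ⟨R, hR, h₀, hh₀, fun h hh U f hU hcurve hinj S hSU hS => ?_⟩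
  intro d
  obtain ⟨⟨K, hK⟩, hJ⟩ := H h hh U f hU hcurve
  have hae : ∀ᵐ y ∂(μ.restrict S), y ∈ U ∧ DifferentiableAt ℝ f y := by
    filter_upwards [ae_restrict_of_ae (hK.ae_differentiableWithinAt_of_mem (μ := μ)),
      ae_restrict_mem hS] with y hy hyS
    exact ⟨hSU hyS, (hy (hSU hyS)).differentiableAt (hU.mem_nhds (hSU hyS))⟩
  have key : ∀ y, y ∈ U ∧ DifferentiableAt ℝ f y →
      Real.exp (h * (d - ε)) * ρ y ≤ |(fderiv ℝ f y).det| * ρ (f y) ∧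
      |(fderiv ℝ f y).det| * ρ (f y) ≤ Real.exp (h * (d + ε)) * ρ y := by
    rintro y ⟨hy, hd⟩
    obtain ⟨h1, h2, h3⟩ := hJ y hy
    obtain ⟨h4, h5⟩ := h3 hd
    change |_ - h * d| ≤ _ at h5
    rw [abs_le] at h5
    rw [abs_of_pos h4]
    have e1 : (fderiv ℝ f y).det * ρ (f y)
        = Real.exp (Real.log (fderiv ℝ f y).det + Real.log (ρ (f y))) := by
      rw [Real.exp_add, Real.exp_log h4, Real.exp_log h2]
    have e2 : ∀ c : ℝ, Real.exp c * ρ y = Real.exp (c + Real.log (ρ y)) := fun c => by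
      rw [Real.exp_add, Real.exp_log h1]
    rw [e1, e2, e2]
    constructor
    · apply Real.exp_le_exp.2; linarith [h5.1]
    · apply Real.exp_le_exp.2; linarith [h5.2]
  rw [lintegral_image_of_lipschitzOnWith hU hK hinj hS hSU,
    ← lintegral_const_mul' _ _ ENNReal.ofReal_ne_top,
    ← lintegral_const_mul' _ _ ENNReal.ofReal_ne_top]
  constructor
  · refine lintegral_mono_ae (hae.mono fun y hy => ?_)
    rw [← ENNReal.ofReal_mul (Real.exp_pos _).le, ← ENNReal.ofReal_mul (abs_nonneg _)]
    exact ENNReal.ofReal_le_ofReal (key y hy).1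
  · refine lintegral_mono_ae (hae.mono fun y hy => ?_)
    rw [← ENNReal.ofReal_mul (Real.exp_pos _).le, ← ENNReal.ofReal_mul (abs_nonneg _)]
    exact ENNReal.ofReal_le_ofReal (key y hy).2

end EuclideanMeasure

section

variable {n : ℕ} {M : Type*} [TopologicalSpace M] [ChartedSpace (EuclideanSpace ℝ (Fin n)) M]

section Charts

theorem one_le_smooth : (1 : WithTop ℕ∞) ≤ ((⊤ : ℕ∞) : WithTop ℕ∞) := mod_cast le_top

theorem one_add_one_le_smooth : (1 : WithTop ℕ∞) + 1 ≤ ((⊤ : ℕ∞) : WithTop ℕ∞) :=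
  WithTop.coe_le_coe.2 (le_top (a := (1 : ℕ∞) + 1))

variable [IsManifold (𝓡 n) ∞ M]

/-! ### Coordinate expressions -/

theorem contMDiffOn_chart {φ : OpenPartialHomeomorph M (EuclideanSpace ℝ (Fin n))}
    (hφ : φ ∈ atlas (EuclideanSpace ℝ (Fin n)) M) :
    ContMDiffOn (𝓡 n) (𝓡 n) ∞ φ φ.source :=
  contMDiffOn_of_mem_maximalAtlas (IsManifold.subset_maximalAtlas hφ)

theorem contMDiffOn_chart_symm {φ : OpenPartialHomeomorph M (EuclideanSpace ℝ (Fin n))}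
    (hφ : φ ∈ atlas (EuclideanSpace ℝ (Fin n)) M) :
    ContMDiffOn (𝓡 n) (𝓡 n) ∞ φ.symm φ.target :=
  contMDiffOn_symm_of_mem_maximalAtlas (IsManifold.subset_maximalAtlas hφ)

/-- The coordinate field is the tangent map of the smooth chart applied to the `C^1` section `X`
along `φ.symm`. -/
theorem contDiffOn_coordField {φ : OpenPartialHomeomorph M (EuclideanSpace ℝ (Fin n))}
    (hφ : φ ∈ atlas (EuclideanSpace ℝ (Fin n)) M) {X : VField n M} (hX : IsC1 X) :
    ContDiffOn ℝ 1 (coordField X φ) φ.target := by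
  have h1 : ContMDiffOn (𝓡 n).tangent (𝓡 n).tangent 1 (tangentMapWithin (𝓡 n) (𝓡 n) φ φ.source)
      (Bundle.TotalSpace.proj ⁻¹' φ.source) :=
    (contMDiffOn_chart hφ).contMDiffOn_tangentMapWithin (m := 1) one_add_one_le_smooth
      φ.open_source.uniqueMDiffOn
  have h2 : ContMDiffOn (𝓡 n) (𝓡 n).tangent 1
      (fun y => (⟨φ.symm y, X (φ.symm y)⟩ : TangentBundle (𝓡 n) M)) φ.target :=
    hX.comp_contMDiffOn ((contMDiffOn_chart_symm hφ).of_le one_le_smooth)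
  have h3 := h1.comp h2 (fun y hy => φ.map_target hy)
  refine (contMDiffOn_vectorSpace_iff_contDiffOn (V := coordField X φ)).1 ?_
  refine h3.congr fun y hy => ?_
  simp only [Function.comp_apply, tangentMapWithin, coordField]
  rw [mfderivWithin_of_isOpen φ.open_source (φ.map_target hy), φ.right_inv hy]

theorem contMDiffOn_coordVector {φ : OpenPartialHomeomorph M (EuclideanSpace ℝ (Fin n))}
    (hφ : φ ∈ atlas (EuclideanSpace ℝ (Fin n)) M) (i : Fin n) :
    ContMDiffOn (𝓡 n) (𝓡 n).tangent 1
      (fun y => (⟨φ.symm y, coordVector φ y i⟩ : TangentBundle (𝓡 n) M)) φ.target := by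
  have h1 : ContMDiffOn (𝓡 n).tangent (𝓡 n).tangent 1
      (tangentMapWithin (𝓡 n) (𝓡 n) φ.symm φ.target)
      (Bundle.TotalSpace.proj ⁻¹' φ.target) :=
    (contMDiffOn_chart_symm hφ).contMDiffOn_tangentMapWithin (m := 1) one_add_one_le_smooth
      φ.open_target.uniqueMDiffOn
  have h2 : ContMDiffOn (𝓡 n) (𝓡 n).tangent 1
      (fun y => (⟨y, (EuclideanSpace.single i (1 : ℝ) : EuclideanSpace ℝ (Fin n))⟩ :
        TangentBundle (𝓡 n) (EuclideanSpace ℝ (Fin n)))) φ.target :=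
    contMDiffOn_vectorSpace_iff_contDiffOn.2 contDiffOn_const
  refine (h1.comp h2 (fun y hy => hy)).congr fun y hy => ?_
  simp only [Function.comp_apply, tangentMapWithin, coordVector]
  rw [mfderivWithin_of_isOpen φ.open_target hy]

theorem contDiffOn_gram (g : Metric n M)
    {φ : OpenPartialHomeomorph M (EuclideanSpace ℝ (Fin n))}
    (hφ : φ ∈ atlas (EuclideanSpace ℝ (Fin n)) M) (i j : Fin n) :
    ContDiffOn ℝ 1 (fun y => gram g φ y i j) φ.target := by
  rw [← contMDiffOn_iff_contDiffOn]
  have hg := (g.contMDiff.of_le one_le_smooth).comp_contMDiffOn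
    ((contMDiffOn_chart_symm hφ).of_le one_le_smooth)
  have h3 : ContMDiffOn (𝓡 n) ((𝓡 n).prod 𝓘(ℝ, ℝ)) 1
      (fun y ↦ Bundle.TotalSpace.mk' ℝ (E := Bundle.Trivial M ℝ) (φ.symm y)
        (g.inner (φ.symm y) (coordVector φ y i) (coordVector φ y j))) φ.target :=
    ContMDiffOn.clm_bundle_apply₂ (F₁ := EuclideanSpace ℝ (Fin n))
      (F₂ := EuclideanSpace ℝ (Fin n))
      hg (contMDiffOn_coordVector hφ i) (contMDiffOn_coordVector hφ j)
  intro y hy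
  have h4 := h3 y hy
  rw [Bundle.contMDiffWithinAt_totalSpace] at h4
  exact h4.2

theorem mfderiv_chart_symm_comp {φ : OpenPartialHomeomorph M (EuclideanSpace ℝ (Fin n))}
    (hφ : φ ∈ atlas (EuclideanSpace ℝ (Fin n)) M) {y : EuclideanSpace ℝ (Fin n)}
    (hy : y ∈ φ.target) :
    (mfderiv (𝓡 n) (𝓡 n) φ.symm y).comp (mfderiv (𝓡 n) (𝓡 n) φ (φ.symm y))
      = ContinuousLinearMap.id ℝ _ := by
  have := (mdifferentiable_of_mem_atlas (I := 𝓡 n) hφ).symm_comp_deriv (φ.map_target hy)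
  rwa [φ.right_inv hy] at this

theorem injective_mfderiv_chart_symm {φ : OpenPartialHomeomorph M (EuclideanSpace ℝ (Fin n))}
    (hφ : φ ∈ atlas (EuclideanSpace ℝ (Fin n)) M) {y : EuclideanSpace ℝ (Fin n)}
    (hy : y ∈ φ.target) : Function.Injective (mfderiv (𝓡 n) (𝓡 n) φ.symm y) :=
  (mdifferentiable_of_mem_atlas (I := 𝓡 n) hφ).symm.mfderiv_injective hy

theorem inner_mfderiv_chart_symm (g : Metric n M)
    (φ : OpenPartialHomeomorph M (EuclideanSpace ℝ (Fin n))) (y : EuclideanSpace ℝ (Fin n))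
    (v w : EuclideanSpace ℝ (Fin n)) :
    g.inner (φ.symm y) (mfderiv (𝓡 n) (𝓡 n) φ.symm y v) (mfderiv (𝓡 n) (𝓡 n) φ.symm y w)
      = ∑ i, ∑ j, v i * w j * gram g φ y i j := by
  let D : EuclideanSpace ℝ (Fin n) →L[ℝ] EuclideanSpace ℝ (Fin n) :=
    mfderiv (𝓡 n) (𝓡 n) φ.symm y
  let G : EuclideanSpace ℝ (Fin n) →L[ℝ] EuclideanSpace ℝ (Fin n) →L[ℝ] ℝ := g.inner (φ.symm y)
  change G (D v) (D w) = ∑ i, ∑ j, v i * w j *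
    G (D (EuclideanSpace.single i 1)) (D (EuclideanSpace.single j 1))
  have hv : ∀ v : EuclideanSpace ℝ (Fin n), v = ∑ i, v i • EuclideanSpace.single i (1 : ℝ) := by
    intro v
    ext k
    simp [Finset.sum_apply, Pi.single_apply]
  conv_lhs => rw [hv v, hv w]
  simp only [map_sum, map_smul, sum_apply, smul_apply, smul_eq_mul, Finset.mul_sum]
  rw [Finset.sum_comm]
  refine Finset.sum_congr rfl fun i _ => Finset.sum_congr rfl fun j _ => ?_
  ring

theorem posDef_gram (g : Metric n M)
    {φ : OpenPartialHomeomorph M (EuclideanSpace ℝ (Fin n))}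
    (hφ : φ ∈ atlas (EuclideanSpace ℝ (Fin n)) M) {y : EuclideanSpace ℝ (Fin n)}
    (hy : y ∈ φ.target) : (gram g φ y).PosDef := by
  refine Matrix.PosDef.of_dotProduct_mulVec_pos ?_ fun x hx => ?_
  · ext i j
    simp [gram, g.symm (φ.symm y) (coordVector φ y i)]
  · have h0 : (WithLp.toLp 2 x : EuclideanSpace ℝ (Fin n)) ≠ 0 := by simpa using hx
    have h1 := g.pos (φ.symm y) (mfderiv (𝓡 n) (𝓡 n) φ.symm y (WithLp.toLp 2 x))
      (fun h => h0 (injective_mfderiv_chart_symm hφ hy (h.trans (map_zero _).symm)))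
    refine h1.trans_eq ?_
    rw [inner_mfderiv_chart_symm]
    simp only [dotProduct, Matrix.mulVec, Finset.mul_sum]
    refine Finset.sum_congr rfl fun i _ => Finset.sum_congr rfl fun j _ => ?_
    simp
    ring

theorem density_pos (g : Metric n M)
    {φ : OpenPartialHomeomorph M (EuclideanSpace ℝ (Fin n))}
    (hφ : φ ∈ atlas (EuclideanSpace ℝ (Fin n)) M) {y : EuclideanSpace ℝ (Fin n)}
    (hy : y ∈ φ.target) : 0 < density g φ y :=
  Real.sqrt_pos.2 (posDef_gram g hφ hy).det_pos

theorem contDiffOn_density (g : Metric n M)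
    {φ : OpenPartialHomeomorph M (EuclideanSpace ℝ (Fin n))}
    (hφ : φ ∈ atlas (EuclideanSpace ℝ (Fin n)) M) :
    ContDiffOn ℝ 1 (density g φ) φ.target := by
  unfold density
  refine ContDiffOn.sqrt ?_ fun y hy => (posDef_gram g hφ hy).det_pos.ne'
  simp only [Matrix.det_apply]
  refine ContDiffOn.sum fun σ _ => ContDiffOn.const_smul _ ?_
  exact contDiffOn_prod fun i _ => contDiffOn_gram g hφ _ _

end Charts

end

section

theorem measurableSet_target_inter_preimage_symm {n : ℕ} {M : Type*} [TopologicalSpace M]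
    [MeasurableSpace M] [BorelSpace M] (φ : OpenPartialHomeomorph M (EuclideanSpace ℝ (Fin n)))
    {A : Set M} (hA : MeasurableSet A) :
    MeasurableSet (φ.target ∩ φ.symm ⁻¹' A) := by
  have h1 : Measurable (φ.target.domRestrict φ.symm) :=
    (continuousOn_iff_continuous_domRestrict.1 φ.continuousOn_symm).measurable
  have h2 := φ.open_target.measurableSet.subtype_image (h1 hA)
  convert h2 using 1
  ext y
  simp [and_comm]

variable {n : ℕ} {M : Type*} [TopologicalSpace M] [ChartedSpace (EuclideanSpace ℝ (Fin n)) M]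

section Volume

variable [IsManifold (𝓡 n) ∞ M]

/-! ### The Riemannian volume in a chart -/

theorem differentiableAt_chart_transition {φ ψ : OpenPartialHomeomorph M (EuclideanSpace ℝ (Fin n))}
    (hφ : φ ∈ atlas (EuclideanSpace ℝ (Fin n)) M) (hψ : ψ ∈ atlas (EuclideanSpace ℝ (Fin n)) M)
    {y : EuclideanSpace ℝ (Fin n)} (hy : y ∈ ψ.target) (hy' : ψ.symm y ∈ φ.source) :
    DifferentiableAt ℝ (fun z => φ (ψ.symm z)) y :=
  ((mdifferentiableAt_atlas (I := 𝓡 n) hφ hy').comp y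
    (mdifferentiableAt_atlas_symm (I := 𝓡 n) hψ hy)).differentiableAt

theorem mfderiv_chart_symm_eq {φ ψ : OpenPartialHomeomorph M (EuclideanSpace ℝ (Fin n))}
    (hφ : φ ∈ atlas (EuclideanSpace ℝ (Fin n)) M) (hψ : ψ ∈ atlas (EuclideanSpace ℝ (Fin n)) M)
    {y : EuclideanSpace ℝ (Fin n)} (hy : y ∈ ψ.target) (hy' : ψ.symm y ∈ φ.source)
    (v : EuclideanSpace ℝ (Fin n)) :
    (mfderiv (𝓡 n) (𝓡 n) ψ.symm y v : EuclideanSpace ℝ (Fin n)) =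
      mfderiv (𝓡 n) (𝓡 n) φ.symm (φ (ψ.symm y)) (fderiv ℝ (fun z => φ (ψ.symm z)) y v) := by
  have hev : ψ.symm =ᶠ[𝓝 y] φ.symm ∘ fun z => φ (ψ.symm z) := by
    filter_upwards [(ψ.isOpen_inter_preimage_symm φ.open_source).mem_nhds ⟨hy, hy'⟩] with z hz
    exact (φ.left_inv hz.2).symm
  have h1 : MDifferentiableAt (𝓡 n) (𝓡 n) (fun z => φ (ψ.symm z)) y :=
    (differentiableAt_chart_transition hφ hψ hy hy').mdifferentiableAt
  have h2 : MDifferentiableAt (𝓡 n) (𝓡 n) φ.symm (φ (ψ.symm y)) :=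
    mdifferentiableAt_atlas_symm (I := 𝓡 n) hφ (φ.map_source hy')
  have h3 : HasMFDerivAt (𝓡 n) (𝓡 n) ψ.symm y
      ((mfderiv (𝓡 n) (𝓡 n) φ.symm (φ (ψ.symm y))).comp
        (mfderiv (𝓡 n) (𝓡 n) (fun z => φ (ψ.symm z)) y)) :=
    (h2.hasMFDerivAt.comp y h1.hasMFDerivAt).congr_of_eventuallyEq hev
  rw [h3.mfderiv, ← mfderiv_eq_fderiv]
  rfl

/-- The Gram matrices are congruent through the Jacobian matrix `P` of the transition map, so their
determinants differ by `P.det ^ 2`. -/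
theorem density_chart_transition (g : Metric n M)
    {φ ψ : OpenPartialHomeomorph M (EuclideanSpace ℝ (Fin n))}
    (hφ : φ ∈ atlas (EuclideanSpace ℝ (Fin n)) M) (hψ : ψ ∈ atlas (EuclideanSpace ℝ (Fin n)) M)
    {y : EuclideanSpace ℝ (Fin n)} (hy : y ∈ ψ.target) (hy' : ψ.symm y ∈ φ.source) :
    density g ψ y = |(fderiv ℝ (fun z => φ (ψ.symm z)) y).det| * density g φ (φ (ψ.symm y)) := by
  set D := fderiv ℝ (fun z => φ (ψ.symm z)) y with hD
  let b := (EuclideanSpace.basisFun (Fin n) ℝ).toBasis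
  set P := LinearMap.toMatrix b b (D : EuclideanSpace ℝ (Fin n) →ₗ[ℝ] EuclideanSpace ℝ (Fin n))
    with hP
  have hPe : ∀ i j, P i j = D (EuclideanSpace.single j 1) i := by
    intro i j
    simp [hP, LinearMap.toMatrix_apply, b]
  have hgram : gram g ψ y = P.transpose * gram g φ (φ (ψ.symm y)) * P := by
    ext i j
    have hpt : φ.symm (φ (ψ.symm y)) = ψ.symm y := φ.left_inv hy'
    -- The base points `φ.symm (φ (ψ.symm y))` and `ψ.symm y` are only propositionally equal;
    -- quantifying over `p` lets the tangent vectors be moved along this equality.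
    have key : ∀ p : M, p = ψ.symm y → ∀ v w v' w' : EuclideanSpace ℝ (Fin n), v = v' → w = w' →
        g.inner (ψ.symm y) (show TangentSpace (𝓡 n) (ψ.symm y) from v)
          (show TangentSpace (𝓡 n) (ψ.symm y) from w) =
        g.inner p (show TangentSpace (𝓡 n) p from v') (show TangentSpace (𝓡 n) p from w') := by
      rintro _ rfl _ _ _ _ rfl rfl
      rfl
    refine (key _ hpt _ _ _ _ (mfderiv_chart_symm_eq hφ hψ hy hy' (EuclideanSpace.single i 1))
      (mfderiv_chart_symm_eq hφ hψ hy hy' (EuclideanSpace.single j 1))).trans ?_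
    refine (inner_mfderiv_chart_symm g φ _ _ _).trans ?_
    simp only [Matrix.mul_apply, Matrix.transpose_apply, hPe, Finset.sum_mul]
    rw [Finset.sum_comm]
    refine Finset.sum_congr rfl fun k _ => Finset.sum_congr rfl fun l _ => ?_
    rw [← hD]
    ring
  have hdet : D.det = P.det := by
    rw [ContinuousLinearMap.det, ← LinearMap.det_toMatrix b]
  unfold density
  rw [hgram, Matrix.det_mul, Matrix.det_mul, Matrix.det_transpose, hdet,
    show P.det * (gram g φ (φ (ψ.symm y))).det * P.det
      = P.det ^ 2 * (gram g φ (φ (ψ.symm y))).det by ring,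
    Real.sqrt_mul (sq_nonneg _), Real.sqrt_sq_eq_abs]

/-! ### Agreement of the chart measures; local finiteness and positivity of the volume -/

variable [MeasurableSpace M] [BorelSpace M]

theorem chartVolume_apply (g : Metric n M)
    (φ : OpenPartialHomeomorph M (EuclideanSpace ℝ (Fin n))) {A : Set M} (hA : MeasurableSet A) :
    chartVolume g φ A
      = ∫⁻ y in φ.target ∩ φ.symm ⁻¹' A, ENNReal.ofReal (density g φ y) := by
  have h1 : AEMeasurable φ.symm ((volume.restrict φ.target).withDensity
      (fun y => ENNReal.ofReal (density g φ y))) :=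
    (φ.continuousOn_symm.aemeasurable φ.open_target.measurableSet).mono_ac
      (withDensity_absolutelyContinuous _ _)
  rw [chartVolume, Measure.map_apply_of_aemeasurable h1 hA, withDensity_apply',
    Measure.restrict_restrict' φ.open_target.measurableSet, inter_comm]

theorem chartVolume_eq_of_subset (g : Metric n M)
    {φ ψ : OpenPartialHomeomorph M (EuclideanSpace ℝ (Fin n))}
    (hφ : φ ∈ atlas (EuclideanSpace ℝ (Fin n)) M) (hψ : ψ ∈ atlas (EuclideanSpace ℝ (Fin n)) M)
    {A : Set M} (hA : MeasurableSet A) (hAφ : A ⊆ φ.source) (hAψ : A ⊆ ψ.source) :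
    chartVolume g φ A = chartVolume g ψ A := by
  rw [chartVolume_apply g φ hA, chartVolume_apply g ψ hA]
  have himg : φ.target ∩ φ.symm ⁻¹' A
      = (fun z => φ (ψ.symm z)) '' (ψ.target ∩ ψ.symm ⁻¹' A) := by
    ext y
    constructor
    · rintro ⟨hy, hyA⟩
      refine ⟨ψ (φ.symm y), ⟨ψ.map_source (hAψ hyA), ?_⟩, ?_⟩
      · rw [mem_preimage, ψ.left_inv (hAψ hyA)]; exact hyA
      · simp only
        rw [ψ.left_inv (hAψ hyA), φ.right_inv hy]
    · rintro ⟨z, ⟨hz, hzA⟩, rfl⟩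
      refine ⟨φ.map_source (hAφ hzA), ?_⟩
      rw [mem_preimage, φ.left_inv (hAφ hzA)]
      exact hzA
  rw [himg, lintegral_image_eq_lintegral_abs_det_fderiv_mul volume
    (measurableSet_target_inter_preimage_symm ψ hA)
    (fun y hy => (differentiableAt_chart_transition hφ hψ hy.1
      (hAφ hy.2)).hasFDerivAt.hasFDerivWithinAt)]
  · refine setLIntegral_congr_fun (measurableSet_target_inter_preimage_symm ψ hA) fun y hy => ?_
    rw [← ENNReal.ofReal_mul (abs_nonneg _), density_chart_transition g hφ hψ hy.1 (hAφ hy.2)]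
  · intro y hy z hz hyz
    exact ψ.symm.injOn hy.1 hz.1 (φ.injOn (hAφ hy.2) (hAφ hz.2) hyz)

theorem chartVolume_inter_source (g : Metric n M)
    (φ : OpenPartialHomeomorph M (EuclideanSpace ℝ (Fin n))) {A : Set M} (hA : MeasurableSet A) :
    chartVolume g φ (A ∩ φ.source) = chartVolume g φ A := by
  rw [chartVolume_apply g φ hA,
    chartVolume_apply g φ (hA.inter φ.open_source.measurableSet)]
  congr 2
  ext y
  simp only [mem_inter_iff, mem_preimage]
  exact ⟨fun h => ⟨h.1, h.2.1⟩, fun h => ⟨h.1, h.2, φ.map_target h.1⟩⟩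

theorem riemannianVolume_apply_of_subset_source (g : Metric n M)
    {φ : OpenPartialHomeomorph M (EuclideanSpace ℝ (Fin n))}
    (hφ : φ ∈ atlas (EuclideanSpace ℝ (Fin n)) M) {A : Set M} (hA : MeasurableSet A)
    (hAφ : A ⊆ φ.source) :
    riemannianVolume g A
      = ∫⁻ y in φ.target ∩ φ.symm ⁻¹' A, ENNReal.ofReal (density g φ y) := by
  rw [← chartVolume_apply g φ hA]
  have hle : ∀ ψ ∈ atlas (EuclideanSpace ℝ (Fin n)) M, chartVolume g ψ ≤ riemannianVolume g :=
    fun ψ hψ => le_iSup₂ (f := fun ψ (_ : ψ ∈ atlas (EuclideanSpace ℝ (Fin n)) M) =>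
      chartVolume g ψ) ψ hψ
  refine le_antisymm ?_ (hle φ hφ A)
  -- A supremum of measures is not computed set by set. It is bounded by exhibiting one measure
  -- above every `chartVolume g ψ`, whose second summand vanishes inside `φ.source`.
  have hub : riemannianVolume g
      ≤ chartVolume g φ + (riemannianVolume g).restrict φ.sourceᶜ := by
    refine iSup₂_le fun ψ hψ => Measure.le_iff.2 fun B hB => ?_
    have hs := φ.open_source.measurableSet
    rw [Measure.add_apply, Measure.restrict_apply hB, ← sdiff_eq, ← measure_inter_add_sdiff B hs]
    refine add_le_add ?_ (hle ψ hψ _)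
    rw [← chartVolume_inter_source g ψ (hB.inter hs), chartVolume_eq_of_subset g hψ hφ
      ((hB.inter hs).inter ψ.open_source.measurableSet) inter_subset_right
      (inter_subset_left.trans inter_subset_right)]
    exact measure_mono (inter_subset_left.trans inter_subset_left)
  refine (hub A).trans ?_
  rw [Measure.add_apply, Measure.restrict_apply hA, ← sdiff_eq, sdiff_eq_empty.2 hAφ,
    measure_empty, add_zero]

theorem isLocallyFiniteMeasure_riemannianVolume (g : Metric n M) :
    IsLocallyFiniteMeasure (riemannianVolume g) := by
  refine ⟨fun p => ?_⟩
  set φ := chartAt (EuclideanSpace ℝ (Fin n)) p with hφ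
  have hφa : φ ∈ atlas (EuclideanSpace ℝ (Fin n)) M := chart_mem_atlas _ p
  have hp : p ∈ φ.source := mem_chart_source _ p
  obtain ⟨r, hr, hrt⟩ := Metric.nhds_basis_closedBall.mem_iff.1
    (φ.open_target.mem_nhds (φ.map_source hp))
  have hopen : IsOpen (φ.source ∩ φ ⁻¹' Metric.ball (φ p) r) :=
    φ.isOpen_inter_preimage Metric.isOpen_ball
  refine ⟨_, hopen.mem_nhds ⟨hp, Metric.mem_ball_self hr⟩, ?_⟩
  rw [riemannianVolume_apply_of_subset_source g hφa hopen.measurableSet inter_subset_left]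
  refine (lintegral_mono_set (t := Metric.closedBall (φ p) r) ?_).trans_lt ?_
  · rintro y ⟨hy, -, hy2⟩
    rw [mem_preimage, φ.right_inv hy] at hy2
    exact Metric.ball_subset_closedBall hy2
  · have hint : IntegrableOn (density g φ) (Metric.closedBall (φ p) r) volume :=
      ((contDiffOn_density g hφa).continuousOn.mono hrt).integrableOn_compact
        (isCompact_closedBall _ _)
    exact hint.lintegral_lt_top

theorem riemannianVolume_pos_of_isOpen (g : Metric n M) {V : Set M} (hV : IsOpen V)
    (hne : V.Nonempty) : 0 < riemannianVolume g V := by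
  obtain ⟨p, hp⟩ := hne
  set φ := chartAt (EuclideanSpace ℝ (Fin n)) p with hφ
  have hφa : φ ∈ atlas (EuclideanSpace ℝ (Fin n)) M := chart_mem_atlas _ p
  have hps : p ∈ φ.source := mem_chart_source _ p
  refine lt_of_lt_of_le ?_ (measure_mono (μ := riemannianVolume g) (s := V ∩ φ.source)
    inter_subset_left)
  have ho : IsOpen (V ∩ φ.source) := hV.inter φ.open_source
  rw [riemannianVolume_apply_of_subset_source g hφa ho.measurableSet inter_subset_right]
  set S := φ.target ∩ φ.symm ⁻¹' (V ∩ φ.source) with hS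
  have hSo : IsOpen S := φ.isOpen_inter_preimage_symm ho
  have hSne : S.Nonempty := ⟨φ p, φ.map_source hps, by
    rw [mem_preimage, φ.left_inv hps]; exact ⟨hp, hps⟩⟩
  have hpos : ∀ y ∈ S, 0 < ENNReal.ofReal (density g φ y) := fun y hy =>
    ENNReal.ofReal_pos.2 (density_pos g hφa hy.1)
  rw [pos_iff_ne_zero]
  intro h0
  have hm : AEMeasurable (fun y => ENNReal.ofReal (density g φ y)) (volume.restrict S) :=
    (((contDiffOn_density g hφa).continuousOn.mono inter_subset_left).aemeasurable
      hSo.measurableSet).ennreal_ofReal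
  rw [lintegral_eq_zero_iff' hm] at h0
  have h1 : ∀ᵐ y ∂(volume.restrict S), False := by
    filter_upwards [h0, ae_restrict_mem hSo.measurableSet] with y hy hyS
    exact (hpos y hyS).ne' hy
  have h2 : volume S = 0 := by simpa using h1
  exact (hSo.measure_pos volume hSne).ne' h2

end Volume

end

section

/-! ### The flow -/

/-- Picard-Lindelöf. Joint continuity of the solution at `(y₀, 0)` keeps all nearby trajectories in
the prescribed ball for a common time. -/
theorem exists_local_flow {E : Type*} [NormedAddCommGroup E] [NormedSpace ℝ E] [CompleteSpace E]
    {Y : E → E} {y₀ : E} (hY : ContDiffAt ℝ 1 Y y₀) {R : ℝ} (hR : 0 < R) :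
    ∃ r > 0, ∃ h₀ > 0, ∃ α : E → ℝ → E,
      (∀ y ∈ Metric.ball y₀ r, α y 0 = y ∧ ∀ s ∈ Ioo (-h₀) h₀,
        HasDerivAt (α y) (Y (α y s)) s ∧ α y s ∈ Metric.ball y₀ R) ∧
      ∀ s ∈ Ioo (-h₀) h₀, ContinuousOn (fun y => α y s) (Metric.ball y₀ r) := by
  obtain ⟨ε, hε, a, r, L, K, hr, hpl⟩ := IsPicardLindelof.of_contDiffAt_one hY
  obtain ⟨α, hα, hcont⟩ := (hpl 0).exists_forall_mem_closedBall_eq_hasDerivWithinAt_continuousOn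
  simp only [zero_sub, zero_add] at hα hcont
  have hr' : (0 : ℝ) < r := hr
  have hmem : Metric.closedBall y₀ (r : ℝ) ×ˢ Icc (-ε) ε ∈ 𝓝 (y₀, (0 : ℝ)) :=
    prod_mem_nhds (Metric.closedBall_mem_nhds _ hr') (Icc_mem_nhds (by linarith) hε)
  have hc0 : ContinuousAt α (y₀, 0) := hcont.continuousAt hmem
  have h00 : α (y₀, 0) = y₀ := (hα y₀ (Metric.mem_closedBall_self hr'.le)).1
  have hev : ∀ᶠ q in 𝓝 y₀ ×ˢ 𝓝 (0 : ℝ), α q ∈ Metric.ball y₀ R := by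
    rw [← nhds_prod_eq]
    exact hc0.eventually_mem (by rw [h00]; exact Metric.ball_mem_nhds _ hR)
  obtain ⟨p, hp, q, hq, hpq⟩ := eventually_prod_iff.1 hev
  obtain ⟨r₁, hr₁, hp'⟩ := Metric.eventually_nhds_iff_ball.1 hp
  obtain ⟨h₁, hh₁, hq'⟩ := Metric.eventually_nhds_iff_ball.1 hq
  have hball : Metric.ball y₀ (min r₁ r) ⊆ Metric.closedBall y₀ (r : ℝ) :=
    (Metric.ball_subset_ball (min_le_right _ _)).trans Metric.ball_subset_closedBall
  have hI : ∀ s ∈ Ioo (-min h₁ ε) (min h₁ ε), s ∈ Metric.ball (0 : ℝ) h₁ ∧ s ∈ Ioo (-ε) ε := by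
    intro s hs
    rw [mem_Ioo, ← abs_lt, lt_min_iff] at hs
    exact ⟨by simpa using hs.1, abs_lt.1 hs.2⟩
  refine ⟨min r₁ r, lt_min hr₁ hr', min h₁ ε, lt_min hh₁ hε, fun y s => α (y, s), ?_, ?_⟩
  · intro y hy
    refine ⟨(hα y (hball hy)).1, fun s hs => ⟨?_, ?_⟩⟩
    · exact ((hα y (hball hy)).2 s (Ioo_subset_Icc_self (hI s hs).2)).hasDerivAt
        (Icc_mem_nhds (hI s hs).2.1 (hI s hs).2.2)
    · exact hpq (hp' y (Metric.ball_subset_ball (min_le_left _ _) hy)) (hq' s (hI s hs).1)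
  · intro s hs
    exact hcont.comp (by fun_prop) fun y hy => ⟨hball hy, Ioo_subset_Icc_self (hI s hs).2⟩

variable {n : ℕ} {M : Type*} [TopologicalSpace M] [ChartedSpace (EuclideanSpace ℝ (Fin n)) M]
  [IsManifold (𝓡 n) ∞ M]

theorem hasMFDerivAt_chart_symm_comp {φ : OpenPartialHomeomorph M (EuclideanSpace ℝ (Fin n))}
    (hφ : φ ∈ atlas (EuclideanSpace ℝ (Fin n)) M) {X : VField n M}
    {u : ℝ → EuclideanSpace ℝ (Fin n)} {s : ℝ} (hu : HasDerivAt u (coordField X φ (u s)) s)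
    (hus : u s ∈ φ.target) :
    HasMFDerivAt 𝓘(ℝ, ℝ) (𝓡 n) (fun t => φ.symm (u t)) s
      ((1 : ℝ →L[ℝ] ℝ).smulRight (X (φ.symm (u s)))) := by
  have h1 : HasMFDerivAt 𝓘(ℝ, ℝ) (𝓡 n) u s
      ((1 : ℝ →L[ℝ] ℝ).smulRight (coordField X φ (u s))) := by
    exact hu.hasFDerivAt.hasMFDerivAt
  have h2 : HasMFDerivAt (𝓡 n) (𝓡 n) φ.symm (u s) (mfderiv (𝓡 n) (𝓡 n) φ.symm (u s)) :=
    (mdifferentiableAt_atlas_symm (I := 𝓡 n) hφ hus).hasMFDerivAt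
  have h3 := h2.comp s h1
  have h4 := congrArg (fun T => T (X (φ.symm (u s)))) (mfderiv_chart_symm_comp hφ hus)
  have h5 : (mfderiv (𝓡 n) (𝓡 n) φ.symm (u s)) (coordField X φ (u s)) = X (φ.symm (u s)) := h4
  refine h3.congr_mfderiv ?_
  ext
  change (mfderiv (𝓡 n) (𝓡 n) φ.symm (u s)) ((1 : ℝ) • coordField X φ (u s)) =
    (1 : ℝ) • X (φ.symm (u s))
  rw [one_smul, one_smul, h5]

theorem exists_local_flow_chart {X : VField n M} (hX : IsC1 X) (p : M) {R : ℝ} (hR : 0 < R) :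
    let φ := chartAt (EuclideanSpace ℝ (Fin n)) p
    ∃ r > 0, ∃ h₀ > 0, ∃ α : EuclideanSpace ℝ (Fin n) → ℝ → EuclideanSpace ℝ (Fin n),
      (∀ y ∈ Metric.ball (φ p) r, y ∈ φ.target ∧ α y 0 = y ∧
        IsMIntegralCurveOn (fun t => φ.symm (α y t)) X (Ioo (-h₀) h₀) ∧ ∀ s ∈ Ioo (-h₀) h₀,
          HasDerivAt (α y) (coordField X φ (α y s)) s ∧ α y s ∈ Metric.ball (φ p) R ∧
            α y s ∈ φ.target) ∧
      ∀ s ∈ Ioo (-h₀) h₀, ContinuousOn (fun y => α y s) (Metric.ball (φ p) r) := by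
  intro φ
  have hφ : φ ∈ atlas (EuclideanSpace ℝ (Fin n)) M := chart_mem_atlas _ p
  have hpt : φ p ∈ φ.target := φ.map_source (mem_chart_source _ p)
  obtain ⟨R', hR', hR't⟩ := Metric.isOpen_iff.1 φ.open_target _ hpt
  obtain ⟨r, hr, h₀, hh₀, α, h1, h2⟩ := exists_local_flow
    ((contDiffOn_coordField hφ hX).contDiffAt (φ.open_target.mem_nhds hpt)) (lt_min hR hR')
  refine ⟨r, hr, h₀, hh₀, α, fun y hy => ?_, h2⟩
  obtain ⟨h3, h4⟩ := h1 y hy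
  have h5 : ∀ s ∈ Ioo (-h₀) h₀, α y s ∈ φ.target := fun s hs =>
    hR't (Metric.ball_subset_ball (min_le_right _ _) (h4 s hs).2)
  refine ⟨h3 ▸ h5 0 ⟨by linarith, hh₀⟩, h3, fun s hs => ?_, fun s hs => ⟨(h4 s hs).1,
    Metric.ball_subset_ball (min_le_left _ _) (h4 s hs).2, h5 s hs⟩⟩
  exact (hasMFDerivAt_chart_symm_comp hφ (h4 s hs).1 (h5 s hs)).hasMFDerivWithinAt

/-! ### The global flow on a compact manifold -/

variable [T2Space M] [CompactSpace M]

/-- Compactness turns the local existence times into a uniform one, and a uniform time allows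
indefinite extension. -/
theorem exists_integralCurve {X : VField n M} (hX : IsC1 X) (x : M) :
    ∃ γ : ℝ → M, γ 0 = x ∧ IsMIntegralCurve γ X := by
  have hunif : ∃ ε > 0, ∀ x ∈ (univ : Set M), ∃ γ : ℝ → M, γ 0 = x ∧
      IsMIntegralCurveOn γ X (Ioo (-ε) ε) := by
    refine isCompact_univ.induction_on (p := fun s => ∃ ε > 0, ∀ x ∈ s, ∃ γ : ℝ → M, γ 0 = x ∧
      IsMIntegralCurveOn γ X (Ioo (-ε) ε)) ⟨1, one_pos, fun x hx => hx.elim⟩ ?_ ?_ ?_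
    · rintro s t hst ⟨ε, hε, h⟩
      exact ⟨ε, hε, fun x hx => h x (hst hx)⟩
    · rintro s t ⟨ε, hε, h⟩ ⟨ε', hε', h'⟩
      refine ⟨min ε ε', lt_min hε hε', ?_⟩
      rintro x (hx | hx)
      · obtain ⟨γ, h0, h1⟩ := h x hx
        exact ⟨γ, h0, h1.mono (Ioo_subset_Ioo (neg_le_neg (min_le_left _ _)) (min_le_left _ _))⟩
      · obtain ⟨γ, h0, h1⟩ := h' x hx
        exact ⟨γ, h0, h1.mono (Ioo_subset_Ioo (neg_le_neg (min_le_right _ _)) (min_le_right _ _))⟩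
    · intro p _
      obtain ⟨r, hr, h₀, hh₀, α, h1, -⟩ := exists_local_flow_chart hX p one_pos
      set φ := chartAt (EuclideanSpace ℝ (Fin n)) p
      refine ⟨φ.source ∩ φ ⁻¹' Metric.ball (φ p) r, mem_nhdsWithin_of_mem_nhds
        ((φ.isOpen_inter_preimage Metric.isOpen_ball).mem_nhds
          ⟨mem_chart_source _ p, Metric.mem_ball_self hr⟩), h₀, hh₀, fun x hx => ?_⟩
      obtain ⟨-, h2, h3, -⟩ := h1 _ hx.2
      exact ⟨_, by rw [h2, φ.left_inv hx.1], h3⟩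
  obtain ⟨ε, hε, h⟩ := hunif
  exact exists_isMIntegralCurve_of_isMIntegralCurveOn hX hε (fun x => h x (mem_univ x)) x

theorem isMIntegralCurve_flow {X : VField n M} (hX : IsC1 X) (x : M) :
    flow X 0 x = x ∧ IsMIntegralCurve (fun t => flow X t x) X := by
  have h := exists_integralCurve hX x
  have hflow : (fun t => flow X t x) = h.choose := by
    funext t
    rw [flow, dif_pos h]
  rw [hflow]
  exact ⟨(congrFun hflow 0).trans h.choose_spec.1, h.choose_spec.2⟩

theorem flow_zero {X : VField n M} (hX : IsC1 X) (x : M) : flow X 0 x = x :=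
  (isMIntegralCurve_flow hX x).1

theorem flow_add {X : VField n M} (hX : IsC1 X) (s t : ℝ) (x : M) :
    flow X (s + t) x = flow X s (flow X t x) := by
  have h1 := (isMIntegralCurve_flow hX x).2.comp_add t
  have h2 := (isMIntegralCurve_flow hX (flow X t x)).2
  have h3 := isMIntegralCurve_Ioo_eq_of_contMDiff_boundaryless (t₀ := 0) hX h1 h2
    (by simp [flow_zero hX])
  exact congrFun h3 s

theorem flow_neg_flow {X : VField n M} (hX : IsC1 X) (t : ℝ) (x : M) :
    flow X (-t) (flow X t x) = x := by
  rw [← flow_add hX, neg_add_cancel, flow_zero hX]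

theorem flow_flow_neg {X : VField n M} (hX : IsC1 X) (t : ℝ) (x : M) :
    flow X t (flow X (-t) x) = x := by
  rw [← flow_add hX, add_neg_cancel, flow_zero hX]

theorem flow_injective {X : VField n M} (hX : IsC1 X) (t : ℝ) : Function.Injective (flow X t) :=
  Function.LeftInverse.injective (g := flow X (-t)) (flow_neg_flow hX t)

theorem image_flow_eq_preimage {X : VField n M} (hX : IsC1 X) (t : ℝ) (B : Set M) :
    flow X t '' B = flow X (-t) ⁻¹' B :=
  congrFun (image_eq_preimage_of_inverse (flow_neg_flow hX t) (flow_flow_neg hX t)) B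

theorem flow_eq_of_isMIntegralCurveOn {X : VField n M} (hX : IsC1 X) {γ : ℝ → M} {h₀ : ℝ}
    (hh₀ : 0 < h₀) (hγ : IsMIntegralCurveOn γ X (Ioo (-h₀) h₀)) {s : ℝ} (hs : s ∈ Ioo (-h₀) h₀) :
    flow X s (γ 0) = γ s :=
  isMIntegralCurveOn_Ioo_eqOn_of_contMDiff_boundaryless (t₀ := 0) ⟨by linarith, hh₀⟩ hX
    ((isMIntegralCurve_flow hX (γ 0)).2.isMIntegralCurveOn _) hγ (flow_zero hX _) hs

/-- The local flow in the chart at `p` is the flow. -/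
theorem exists_flow_chart {X : VField n M} (hX : IsC1 X) (p : M) {R : ℝ} (hR : 0 < R) :
    let φ := chartAt (EuclideanSpace ℝ (Fin n)) p
    ∃ r > 0, ∃ h₀ > 0, ∃ α : EuclideanSpace ℝ (Fin n) → ℝ → EuclideanSpace ℝ (Fin n),
      (∀ y ∈ Metric.ball (φ p) r, y ∈ φ.target ∧ α y 0 = y ∧ ∀ s ∈ Ioo (-h₀) h₀,
          HasDerivAt (α y) (coordField X φ (α y s)) s ∧ α y s ∈ Metric.ball (φ p) R ∧
            α y s ∈ φ.target ∧ flow X s (φ.symm y) = φ.symm (α y s)) ∧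
      ∀ s ∈ Ioo (-h₀) h₀, ContinuousOn (fun y => α y s) (Metric.ball (φ p) r) := by
  intro φ
  obtain ⟨r, hr, h₀, hh₀, α, h1, h2⟩ := exists_local_flow_chart hX p hR
  refine ⟨r, hr, h₀, hh₀, α, fun y hy => ?_, h2⟩
  obtain ⟨h3, h4, h5, h6⟩ := h1 y hy
  refine ⟨h3, h4, fun s hs => ⟨(h6 s hs).1, (h6 s hs).2.1, (h6 s hs).2.2, ?_⟩⟩
  have := flow_eq_of_isMIntegralCurveOn hX hh₀ h5 hs
  rwa [h4] at this

theorem exists_continuousOn_flow_mapsTo {X : VField n M} (hX : IsC1 X) (p : M) {V : Set M}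
    (hV : V ∈ 𝓝 p) : ∃ U, IsOpen U ∧ p ∈ U ∧ ∃ h₀ > 0, ∀ s ∈ Ioo (-h₀) h₀,
      ContinuousOn (flow X s) U ∧ MapsTo (flow X s) U V := by
  set φ := chartAt (EuclideanSpace ℝ (Fin n)) p with hφ
  have hps : p ∈ φ.source := mem_chart_source _ p
  have hV' : φ.symm ⁻¹' V ∈ 𝓝 (φ p) :=
    (φ.continuousAt_symm (φ.map_source hps)).preimage_mem_nhds (by rwa [φ.left_inv hps])
  obtain ⟨R, hR, hRV⟩ := Metric.mem_nhds_iff.1 hV'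
  obtain ⟨r, hr, h₀, hh₀, α, h1, h2⟩ := exists_flow_chart hX p hR
  refine ⟨φ.source ∩ φ ⁻¹' Metric.ball (φ p) r, φ.isOpen_inter_preimage Metric.isOpen_ball,
    ⟨hps, Metric.mem_ball_self hr⟩, h₀, hh₀, fun s hs => ?_⟩
  have heq : ∀ x ∈ φ.source ∩ φ ⁻¹' Metric.ball (φ p) r, flow X s x = φ.symm (α (φ x) s) := by
    rintro x ⟨hx, hx'⟩
    have := ((h1 _ hx').2.2 s hs).2.2.2
    rwa [φ.left_inv hx] at this
  refine ⟨ContinuousOn.congr ?_ heq, fun x hx => ?_⟩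
  · exact φ.continuousOn_symm.comp ((h2 s hs).comp (φ.continuousOn.mono inter_subset_left)
      fun x hx => hx.2) fun x hx => ((h1 _ hx.2).2.2 s hs).2.2.1
  · rw [heq x hx]
    exact hRV ((h1 _ hx.2).2.2 s hs).2.1

/-- Short times suffice: only the time `h` map for small `h` is iterated, and the time `-h` map
serves to make images measurable. -/
theorem exists_forall_continuous_flow {X : VField n M} (hX : IsC1 X) :
    ∃ h₀ > 0, ∀ s ∈ Ioo (-h₀) h₀, Continuous (flow X s) := by
  have : ∃ h₀ > 0, ∀ s ∈ Ioo (-h₀) h₀, ∀ x ∈ (univ : Set M), ContinuousAt (flow X s) x := by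
    refine isCompact_univ.induction_on (p := fun S => ∃ h₀ > 0, ∀ s ∈ Ioo (-h₀) h₀, ∀ x ∈ S,
      ContinuousAt (flow X s) x) ⟨1, one_pos, fun s _ x hx => hx.elim⟩ ?_ ?_ ?_
    · rintro s t hst ⟨ε, hε, h⟩
      exact ⟨ε, hε, fun s hs x hx => h s hs x (hst hx)⟩
    · rintro s t ⟨ε, hε, h⟩ ⟨ε', hε', h'⟩
      refine ⟨min ε ε', lt_min hε hε', fun s hs => ?_⟩
      rintro x (hx | hx)
      · exact h s (Ioo_subset_Ioo (neg_le_neg (min_le_left _ _)) (min_le_left _ _) hs) x hx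
      · exact h' s (Ioo_subset_Ioo (neg_le_neg (min_le_right _ _)) (min_le_right _ _) hs) x hx
    · intro p _
      obtain ⟨U, hU, hpU, h₀, hh₀, h⟩ := exists_continuousOn_flow_mapsTo hX p univ_mem
      exact ⟨U, mem_nhdsWithin_of_mem_nhds (hU.mem_nhds hpU), h₀, hh₀, fun s hs x hx =>
        (h s hs).1.continuousAt (hU.mem_nhds hx)⟩
  obtain ⟨h₀, hh₀, h⟩ := this
  exact ⟨h₀, hh₀, fun s hs => continuous_iff_continuousAt.2 fun x => h s hs x (mem_univ x)⟩

end

section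

variable {n : ℕ} {M : Type*} [TopologicalSpace M] [ChartedSpace (EuclideanSpace ℝ (Fin n)) M]
  [IsManifold (𝓡 n) ∞ M]

/-! ### The divergence as the rate of change of volume -/

theorem divergence_eq (g : Metric n M) {X : VField n M} (hX : IsC1 X) (p : M) :
    let φ := chartAt (EuclideanSpace ℝ (Fin n)) p
    divergence g X p = (density g φ (φ p))⁻¹ *
      fderiv ℝ (density g φ) (φ p) (coordField X φ (φ p)) +
        LinearMap.trace ℝ (EuclideanSpace ℝ (Fin n)) (fderiv ℝ (coordField X φ) (φ p)) := by
  intro φ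
  have hφ : φ ∈ atlas (EuclideanSpace ℝ (Fin n)) M := chart_mem_atlas _ p
  have hpt : φ p ∈ φ.target := φ.map_source (mem_chart_source _ p)
  have hY : DifferentiableAt ℝ (coordField X φ) (φ p) :=
    ((contDiffOn_coordField hφ hX).contDiffAt (φ.open_target.mem_nhds hpt)).differentiableAt
      one_ne_zero
  have hρ : DifferentiableAt ℝ (density g φ) (φ p) :=
    ((contDiffOn_density g hφ).contDiffAt (φ.open_target.mem_nhds hpt)).differentiableAt
      one_ne_zero
  have hρ0 : density g φ (φ p) ≠ 0 := (density_pos g hφ hpt).ne'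
  have hterm : ∀ i : Fin n, fderiv ℝ (fun y => density g φ y * coordField X φ y i) (φ p)
      (EuclideanSpace.single i (1 : ℝ)) =
      density g φ (φ p) * (fderiv ℝ (coordField X φ) (φ p) (EuclideanSpace.single i (1 : ℝ))) i +
        coordField X φ (φ p) i * fderiv ℝ (density g φ) (φ p) (EuclideanSpace.single i (1 : ℝ)) := by
    intro i
    have hYi : HasFDerivAt (fun y => coordField X φ y i)
        ((EuclideanSpace.proj i : EuclideanSpace ℝ (Fin n) →L[ℝ] ℝ).comp
          (fderiv ℝ (coordField X φ) (φ p))) (φ p) :=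
      (EuclideanSpace.proj i : EuclideanSpace ℝ (Fin n) →L[ℝ] ℝ).hasFDerivAt.comp (φ p)
        hY.hasFDerivAt
    have h1 : HasFDerivAt (fun y => density g φ y * coordField X φ y i) _ (φ p) :=
      hρ.hasFDerivAt.mul hYi
    rw [h1.fderiv]
    simp
  have htr : LinearMap.trace ℝ (EuclideanSpace ℝ (Fin n)) (fderiv ℝ (coordField X φ) (φ p)) =
      ∑ i, (fderiv ℝ (coordField X φ) (φ p) (EuclideanSpace.single i (1 : ℝ))) i := by
    rw [LinearMap.trace_eq_matrix_trace ℝ (EuclideanSpace.basisFun (Fin n) ℝ).toBasis]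
    simp [Matrix.trace, LinearMap.toMatrix_apply]
  have hsum : fderiv ℝ (density g φ) (φ p) (coordField X φ (φ p)) =
      ∑ i, coordField X φ (φ p) i *
        fderiv ℝ (density g φ) (φ p) (EuclideanSpace.single i (1 : ℝ)) := by
    have hv : coordField X φ (φ p)
        = ∑ i, coordField X φ (φ p) i • EuclideanSpace.single i (1 : ℝ) := by
      ext k
      simp [Finset.sum_apply, Pi.single_apply]
    conv_lhs => rw [hv]
    simp only [map_sum, map_smul, smul_eq_mul]
  change (density g φ (φ p))⁻¹ * ∑ i : Fin n, fderiv ℝ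
    (fun y => density g φ y * coordField X φ y i) (φ p) (EuclideanSpace.single i (1 : ℝ)) = _
  simp only [hterm, Finset.sum_add_distrib, ← Finset.mul_sum]
  rw [htr, hsum, mul_add, inv_mul_cancel_left₀ hρ0, add_comm]

variable [T2Space M] [CompactSpace M] [MeasurableSpace M] [BorelSpace M]

/-- In the chart at `p` the exponent of `exists_lintegral_image_flow_bounds` is exactly the
divergence, by `divergence_eq`. -/
theorem exists_volume_image_flow_bounds (g : Metric n M) {X : VField n M} (hX : IsC1 X) (p : M)
    {ε : ℝ} (hε : 0 < ε) :
    ∃ U, IsOpen U ∧ p ∈ U ∧ ∃ h₀ > 0, ∀ h ∈ Ioc 0 h₀, ∀ B ⊆ U, MeasurableSet B →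
      ENNReal.ofReal (Real.exp (h * (divergence g X p - ε))) * riemannianVolume g B
        ≤ riemannianVolume g (flow X h '' B) ∧
      riemannianVolume g (flow X h '' B)
        ≤ ENNReal.ofReal (Real.exp (h * (divergence g X p + ε))) * riemannianVolume g B := by
  set φ := chartAt (EuclideanSpace ℝ (Fin n)) p with hφd
  have hφ : φ ∈ atlas (EuclideanSpace ℝ (Fin n)) M := chart_mem_atlas _ p
  have hps : p ∈ φ.source := mem_chart_source _ p
  have hpt : φ p ∈ φ.target := φ.map_source hps
  have hY : HasStrictFDerivAt (coordField X φ) (fderiv ℝ (coordField X φ) (φ p)) (φ p) :=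
    ((contDiffOn_coordField hφ hX).contDiffAt (φ.open_target.mem_nhds hpt)).hasStrictFDerivAt
      one_ne_zero
  have hρ : HasStrictFDerivAt (density g φ) (fderiv ℝ (density g φ) (φ p)) (φ p) :=
    ((contDiffOn_density g hφ).contDiffAt (φ.open_target.mem_nhds hpt)).hasStrictFDerivAt
      one_ne_zero
  obtain ⟨R, hR, h₁, hh₁, H⟩ := exists_lintegral_image_flow_bounds
    (μ := (volume : Measure (EuclideanSpace ℝ (Fin n)))) hY hρ (density_pos g hφ hpt) hε
  obtain ⟨h₂, hh₂, hcont⟩ := exists_forall_continuous_flow hX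
  obtain ⟨r, hr, h₃, hh₃, α, hα, -⟩ := exists_flow_chart hX p hR
  have hdiv := divergence_eq g hX p
  simp only [← hφd] at hα hdiv
  refine ⟨φ.source ∩ φ ⁻¹' Metric.ball (φ p) r, φ.isOpen_inter_preimage Metric.isOpen_ball,
    ⟨hps, Metric.mem_ball_self hr⟩, min h₁ (min (h₂ / 2) (h₃ / 2)), by positivity, ?_⟩
  intro h hh B hBU hB
  have hhh₁ : h ∈ Ioc 0 h₁ := ⟨hh.1, hh.2.trans (min_le_left _ _)⟩
  -- The image of `B` at time `h` is its preimage at time `-h`, hence measurable once that map is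
  -- continuous.
  have hhh₂ : -h ∈ Ioo (-h₂) h₂ := by
    have := hh.2.trans ((min_le_right _ _).trans (min_le_left _ _))
    constructor <;> linarith [hh.1]
  have hhh₃ : ∀ s ∈ Icc 0 h, s ∈ Ioo (-h₃) h₃ := fun s hs => by
    have := hh.2.trans ((min_le_right _ _).trans (min_le_right _ _))
    constructor <;> linarith [hs.1, hs.2]
  have hh' : h ∈ Icc 0 h := ⟨hh.1.le, le_rfl⟩
  have hinj : InjOn (fun y => α y h) (Metric.ball (φ p) r) := by
    intro y hy z hz hyz
    obtain ⟨hy1, -, hy2⟩ := hα y hy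
    obtain ⟨hz1, -, hz2⟩ := hα z hz
    refine φ.symm.injOn hy1 hz1 (flow_injective hX h ?_)
    rw [(hy2 h (hhh₃ h hh')).2.2.2, (hz2 h (hhh₃ h hh')).2.2.2]
    exact congrArg φ.symm hyz
  set S := φ.target ∩ φ.symm ⁻¹' B with hS
  have hSm : MeasurableSet S := measurableSet_target_inter_preimage_symm φ hB
  have hSU : S ⊆ Metric.ball (φ p) r := by
    rintro y ⟨hy, hyB⟩
    have := (hBU hyB).2
    rwa [mem_preimage, φ.right_inv hy] at this
  have hmain := H h hhh₁ (Metric.ball (φ p) r) (fun y => α y h) Metric.isOpen_ball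
    (fun y hy => ⟨α y, (hα y hy).2.1, rfl, fun s hs =>
      ⟨((hα y hy).2.2 s (hhh₃ s hs)).1.hasDerivWithinAt, ((hα y hy).2.2 s (hhh₃ s hs)).2.1⟩⟩)
    hinj S hSU hSm
  have hBm : MeasurableSet (flow X h '' B) := by
    rw [image_flow_eq_preimage hX]
    exact (hcont _ hhh₂).measurable hB
  have hflow : ∀ x ∈ B, flow X h x = φ.symm (α (φ x) h) ∧ α (φ x) h ∈ φ.target := by
    intro x hx
    obtain ⟨h1, h2⟩ := hBU hx
    have h3 := (hα _ h2).2.2 h (hhh₃ h hh')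
    rw [φ.left_inv h1] at h3
    exact ⟨h3.2.2.2, h3.2.2.1⟩
  have hBs : flow X h '' B ⊆ φ.source := by
    rintro _ ⟨x, hx, rfl⟩
    rw [(hflow x hx).1]
    exact φ.map_target (hflow x hx).2
  have himg : φ.target ∩ φ.symm ⁻¹' (flow X h '' B) = (fun y => α y h) '' S := by
    ext z
    constructor
    · rintro ⟨hz, x, hx, hxz⟩
      refine ⟨φ x, ⟨φ.map_source (hBU hx).1, ?_⟩, ?_⟩
      · rw [mem_preimage, φ.left_inv (hBU hx).1]
        exact hx
      · rw [(hflow x hx).1] at hxz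
        exact φ.symm.injOn (hflow x hx).2 hz hxz
    · rintro ⟨y, ⟨hy, hyB⟩, rfl⟩
      have h1 := hflow _ hyB
      rw [φ.right_inv hy] at h1
      exact ⟨h1.2, φ.symm y, hyB, h1.1⟩
  rw [riemannianVolume_apply_of_subset_source g hφ hB (hBU.trans inter_subset_left),
    riemannianVolume_apply_of_subset_source g hφ hBm hBs, himg, hdiv]
  exact hmain

/-- The defining formula uses a chart that may jump with the point, so continuity is read off from
volume growth instead: on a common open set of positive finite volume the bounds centred at `p` and
at `q` must be compatible, which forces the two divergences within `2 * ε / 3`. -/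
theorem continuous_divergence (g : Metric n M) {X : VField n M} (hX : IsC1 X) :
    Continuous (divergence g X) := by
  rw [continuous_iff_continuousAt]
  intro p
  rw [ContinuousAt, Metric.tendsto_nhds]
  intro ε hε
  have := isLocallyFiniteMeasure_riemannianVolume g
  obtain ⟨U, hU, hpU, h₀, hh₀, H⟩ := exists_volume_image_flow_bounds g hX p (ε := ε / 3)
    (by positivity)
  filter_upwards [hU.mem_nhds hpU] with q hq
  obtain ⟨U', hU', hqU', h₁, hh₁, H'⟩ := exists_volume_image_flow_bounds g hX q (ε := ε / 3)
    (by positivity)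
  set B := U ∩ U'
  have hB : IsOpen B := hU.inter hU'
  have hB0 : riemannianVolume g B ≠ 0 :=
    (riemannianVolume_pos_of_isOpen g hB ⟨q, hq, hqU'⟩).ne'
  have hBtop : riemannianVolume g B ≠ ⊤ := measure_ne_top _ _
  set h := min h₀ h₁ with hh
  have hh0 : 0 < h := lt_min hh₀ hh₁
  obtain ⟨a1, a2⟩ := H h ⟨hh0, min_le_left _ _⟩ B inter_subset_left hB.measurableSet
  obtain ⟨b1, b2⟩ := H' h ⟨hh0, min_le_right _ _⟩ B inter_subset_right hB.measurableSet
  have key : ∀ a b : ℝ, ENNReal.ofReal (Real.exp (h * a)) * riemannianVolume g B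
      ≤ ENNReal.ofReal (Real.exp (h * b)) * riemannianVolume g B → a ≤ b := by
    intro a b hab
    rw [ENNReal.mul_le_mul_iff_left hB0 hBtop, ENNReal.ofReal_le_ofReal_iff (Real.exp_pos _).le,
      Real.exp_le_exp] at hab
    exact le_of_mul_le_mul_left hab hh0
  have c1 := key _ _ (a1.trans b2)
  have c2 := key _ _ (b1.trans a2)
  rw [Real.dist_eq, abs_lt]
  constructor <;> linarith

end

section

/-! ### Growth of Birkhoff sums along a map that contracts a weighted measure -/

/-- The hypothesis says that `T` pushes `exp d • μ` to a measure below `μ`. Splitting off the first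
term of the Birkhoff sum and pushing forward reduces `N + 1` to `N`. -/
theorem lintegral_exp_birkhoffSum_le {α : Type*} [MeasurableSpace α] {μ : Measure α} {T : α → α}
    (hT : Measurable T) {d : α → ℝ} (hd : Measurable d)
    (h : ∀ C, MeasurableSet C → ∫⁻ x in T ⁻¹' C, ENNReal.ofReal (Real.exp (d x)) ∂μ ≤ μ C)
    (N : ℕ) : ∫⁻ x, ENNReal.ofReal (Real.exp (birkhoffSum T d N x)) ∂μ ≤ μ univ := by
  have hw : Measurable fun x => ENNReal.ofReal (Real.exp (d x)) := hd.exp.ennreal_ofReal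
  have hν : (μ.withDensity fun x => ENNReal.ofReal (Real.exp (d x))).map T ≤ μ := by
    refine Measure.le_iff.2 fun C hC => ?_
    rw [Measure.map_apply hT hC, withDensity_apply _ (hT hC)]
    exact h C hC
  induction N with
  | zero => simp
  | succ N ih =>
    have hS : Measurable fun x => ENNReal.ofReal (Real.exp (birkhoffSum T d N x)) := by
      refine Measurable.ennreal_ofReal (Measurable.exp ?_)
      unfold birkhoffSum
      exact Finset.measurable_sum _ fun k _ => hd.comp (hT.iterate k)
    calc ∫⁻ x, ENNReal.ofReal (Real.exp (birkhoffSum T d (N + 1) x)) ∂μ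
        = ∫⁻ x, ENNReal.ofReal (Real.exp (d x)) *
            ENNReal.ofReal (Real.exp (birkhoffSum T d N (T x))) ∂μ := by
          refine lintegral_congr fun x => ?_
          rw [birkhoffSum_succ', Real.exp_add, ENNReal.ofReal_mul (Real.exp_pos _).le]
      _ = ∫⁻ x, ENNReal.ofReal (Real.exp (birkhoffSum T d N x))
            ∂(μ.withDensity fun x => ENNReal.ofReal (Real.exp (d x))).map T := by
          rw [lintegral_map hS hT]
          exact (lintegral_withDensity_eq_lintegral_mul μ hw (hS.comp hT)).symm
      _ ≤ ∫⁻ x, ENNReal.ofReal (Real.exp (birkhoffSum T d N x)) ∂μ := lintegral_mono' hν le_rfl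
      _ ≤ μ univ := ih

/-- Borel-Cantelli in integrated form: the integrals of `exp (birkhoffSum T d N x - δ * N)` are
dominated by a geometric series, so almost everywhere these terms tend to `0` and are eventually at
most `1`. -/
theorem ae_eventually_birkhoffSum_le {α : Type*} [MeasurableSpace α] {μ : Measure α}
    [IsFiniteMeasure μ] {T : α → α} (hT : Measurable T) {d : α → ℝ} (hd : Measurable d)
    (h : ∀ C, MeasurableSet C → ∫⁻ x in T ⁻¹' C, ENNReal.ofReal (Real.exp (d x)) ∂μ ≤ μ C)
    {δ : ℝ} (hδ : 0 < δ) : ∀ᵐ x ∂μ, ∀ᶠ N : ℕ in atTop, birkhoffSum T d N x ≤ δ * N := by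
  have hS : ∀ N, Measurable fun x => ENNReal.ofReal (Real.exp (birkhoffSum T d N x - δ * N)) := by
    intro N
    refine Measurable.ennreal_ofReal (Measurable.exp (Measurable.sub ?_ measurable_const))
    unfold birkhoffSum
    exact Finset.measurable_sum _ fun k _ => hd.comp (hT.iterate k)
  have hr1 : Real.exp (-δ) < 1 := by rw [← Real.exp_zero]; exact Real.exp_lt_exp.2 (by linarith)
  have hbound : ∀ N : ℕ, ∫⁻ x, ENNReal.ofReal (Real.exp (birkhoffSum T d N x - δ * N)) ∂μ
      ≤ ENNReal.ofReal (Real.exp (-δ)) ^ N * μ univ := by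
    intro N
    have : ∀ x, ENNReal.ofReal (Real.exp (birkhoffSum T d N x - δ * N)) =
        ENNReal.ofReal (Real.exp (-δ)) ^ N *
          ENNReal.ofReal (Real.exp (birkhoffSum T d N x)) := by
      intro x
      rw [← ENNReal.ofReal_pow (Real.exp_pos _).le, ← ENNReal.ofReal_mul (by positivity),
        ← Real.exp_nat_mul, ← Real.exp_add]
      congr 2
      ring
    simp only [this]
    rw [lintegral_const_mul' _ _ (ENNReal.pow_ne_top ENNReal.ofReal_ne_top)]
    gcongr
    exact lintegral_exp_birkhoffSum_le hT hd h N
  have hsum : ∫⁻ x, ∑' N : ℕ, ENNReal.ofReal (Real.exp (birkhoffSum T d N x - δ * N)) ∂μ ≠ ⊤ := by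
    rw [lintegral_tsum fun N => (hS N).aemeasurable]
    refine ne_top_of_le_ne_top ?_ (ENNReal.tsum_le_tsum hbound)
    rw [ENNReal.tsum_mul_right, ENNReal.tsum_geometric]
    refine ENNReal.mul_ne_top (ENNReal.inv_ne_top.2 ?_) (measure_ne_top _ _)
    rw [Ne, tsub_eq_zero_iff_le, not_le]
    exact ENNReal.ofReal_lt_one.2 hr1
  filter_upwards [ae_lt_top (Measurable.tsum hS) hsum] with x hx
  have ht := ENNReal.tendsto_atTop_zero_of_tsum_ne_top hx.ne
  filter_upwards [ht.eventually_le_const one_pos] with N hN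
  rw [ENNReal.ofReal_le_one, Real.exp_le_one_iff] at hN
  linarith

variable {n : ℕ} {M : Type*} [TopologicalSpace M] [ChartedSpace (EuclideanSpace ℝ (Fin n)) M]

/-! ### Time averages of the divergence -/

section EmpiricalMeasures

variable [MeasurableSpace M] [BorelSpace M]

theorem integral_empiricalMeasure (X : VField n M) (x : M) {t : ℝ} (ht : 0 < t) {f : M → ℝ}
    (hf : Continuous f) :
    ∫ y, f y ∂(empiricalMeasure X x t ht : Measure M) = t⁻¹ * ∫ s in (0 : ℝ)..t, f (flow X s x) := by
  change ∫ y, f y ∂((ENNReal.ofReal t)⁻¹ • (volume.restrict (Icc 0 t)).map (fun s => flow X s x)) = _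
  rw [integral_smul_measure, integral_map (continuous_flow X x).aemeasurable
    hf.aestronglyMeasurable, integral_Icc_eq_integral_Ioc,
    ← intervalIntegral.integral_of_le ht.le, ENNReal.toReal_inv, ENNReal.toReal_ofReal ht.le,
    smul_eq_mul]

/-- On a compact space `f` is a bounded continuous test function, so its time averages converge
along the chosen times. -/
theorem integral_le_of_mem_limitMeasures [CompactSpace M] {X : VField n M} {x : M}
    {μ : ProbabilityMeasure M} (hμ : μ ∈ limitMeasures X x) {f : M → ℝ} (hf : Continuous f) {c : ℝ}
    (h : ∀ᶠ t : ℝ in atTop, ∫ s in (0 : ℝ)..t, f (flow X s x) ≤ c * t) :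
    ∫ y, f y ∂(μ : Measure M) ≤ c := by
  obtain ⟨t, ht, htt, hlim⟩ := hμ
  have h1 := (ProbabilityMeasure.tendsto_iff_forall_integral_tendsto.1 hlim)
    (BoundedContinuousFunction.mkOfCompact ⟨f, hf⟩)
  refine le_of_tendsto h1 ?_
  filter_upwards [htt.eventually h] with k hk
  change ∫ y, f y ∂_ ≤ c
  rw [integral_empiricalMeasure X x (ht k) hf, inv_mul_le_iff₀ (ht k)]
  linarith

end EmpiricalMeasures

variable [IsManifold (𝓡 n) ∞ M] [CompactSpace M]

section Flow

variable [T2Space M]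

theorem exists_forall_abs_flow_sub_le {X : VField n M} (hX : IsC1 X) {f : M → ℝ}
    (hf : Continuous f) {ε : ℝ} (hε : 0 < ε) :
    ∃ h₀ > 0, ∀ s ∈ Icc 0 h₀, ∀ x, |f (flow X s x) - f x| ≤ ε := by
  have : ∃ h₀ > 0, ∀ s ∈ Icc 0 h₀, ∀ x ∈ (univ : Set M), |f (flow X s x) - f x| ≤ ε := by
    refine isCompact_univ.induction_on (p := fun S => ∃ h₀ > 0, ∀ s ∈ Icc 0 h₀, ∀ x ∈ S,
      |f (flow X s x) - f x| ≤ ε) ⟨1, one_pos, fun s _ x hx => hx.elim⟩ ?_ ?_ ?_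
    · rintro s t hst ⟨ε, hε, h⟩
      exact ⟨ε, hε, fun s hs x hx => h s hs x (hst hx)⟩
    · rintro s t ⟨ε, hε, h⟩ ⟨ε', hε', h'⟩
      refine ⟨min ε ε', lt_min hε hε', fun s hs => ?_⟩
      rintro x (hx | hx)
      · exact h s ⟨hs.1, hs.2.trans (min_le_left _ _)⟩ x hx
      · exact h' s ⟨hs.1, hs.2.trans (min_le_right _ _)⟩ x hx
    · intro p _
      have hV : {x | |f x - f p| < ε / 2} ∈ 𝓝 p :=
        hf.continuousAt.eventually (Metric.ball_mem_nhds (f p) (half_pos hε))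
      obtain ⟨U, hU, hpU, h₀, hh₀, h⟩ := exists_continuousOn_flow_mapsTo hX p hV
      refine ⟨U ∩ {x | |f x - f p| < ε / 2},
        mem_nhdsWithin_of_mem_nhds (inter_mem (hU.mem_nhds hpU) hV), h₀ / 2, half_pos hh₀, ?_⟩
      rintro s hs x ⟨hxU, hxV⟩
      have h1 : |f (flow X s x) - f p| < ε / 2 :=
        (h s ⟨by linarith [hs.1], by linarith [hs.2]⟩).2 hxU
      have h2 : |f x - f p| < ε / 2 := hxV
      rw [abs_lt] at h1 h2
      rw [abs_le]
      constructor <;> linarith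
  obtain ⟨h₀, hh₀, h⟩ := this
  exact ⟨h₀, hh₀, fun s hs x => h s hs x (mem_univ x)⟩

theorem iterate_flow {X : VField n M} (hX : IsC1 X) (h : ℝ) (k : ℕ) (x : M) :
    (flow X h)^[k] x = flow X (k * h) x := by
  induction k with
  | zero => simp [flow_zero hX]
  | succ k ih =>
    rw [Function.iterate_succ_apply', ih, ← flow_add hX]
    congr 1
    push_cast
    ring

/-- On each time interval of length `h` the integrand stays within `ε` of its value at the left end.
-/
theorem integral_flow_le_birkhoffSum {X : VField n M} (hX : IsC1 X) {f : M → ℝ}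
    (hf : Continuous f) {ε h : ℝ} (hh : 0 < h)
    (hfh : ∀ s ∈ Icc 0 h, ∀ x, |f (flow X s x) - f x| ≤ ε) (x : M) (N : ℕ) :
    ∫ s in (0 : ℝ)..(N * h), f (flow X s x) ≤ h * birkhoffSum (flow X h) f N x + ε * (N * h) := by
  have hc : Continuous fun s => f (flow X s x) := hf.comp (continuous_flow X x)
  have hint : ∀ a b : ℝ, IntervalIntegrable (fun s => f (flow X s x)) volume a b :=
    fun a b => hc.intervalIntegrable a b
  induction N with
  | zero => simp
  | succ N ih =>
    have hstep : ∫ s in (N * h : ℝ)..((N + 1 : ℕ) * h), f (flow X s x)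
        ≤ h * (f ((flow X h)^[N] x) + ε) := by
      have hle : (N * h : ℝ) ≤ (N + 1 : ℕ) * h := by push_cast; nlinarith
      have := intervalIntegral.integral_mono_on hle (hint _ _)
        (intervalIntegrable_const (c := f ((flow X h)^[N] x) + ε)) (fun s hs => by
          have h1 := hfh (s - N * h) ⟨by linarith [hs.1], by
            have := hs.2; push_cast at this; linarith⟩ (flow X (N * h) x)
          rw [← flow_add hX, sub_add_cancel, ← iterate_flow hX] at h1
          linarith [(abs_le.1 h1).2])
      refine this.trans_eq ?_
      rw [intervalIntegral.integral_const, smul_eq_mul]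
      push_cast
      ring
    rw [← intervalIntegral.integral_add_adjacent_intervals (hint 0 (N * h)) (hint _ _),
      birkhoffSum_succ]
    push_cast at hstep ⊢
    linarith

end Flow

variable [MeasurableSpace M] [BorelSpace M]

theorem normalizedVolume_eq_one_of_ae [Nonempty M] (g : Metric n M) {L : Set M}
    (hL : riemannianVolume g Lᶜ = 0) (hLm : MeasurableSet L) : normalizedVolume g L = 1 := by
  have := isLocallyFiniteMeasure_riemannianVolume g
  have h1 : riemannianVolume g L = riemannianVolume g univ := by
    rw [← measure_add_measure_compl hLm, hL, add_zero]
  rw [normalizedVolume, Measure.smul_apply, h1, smul_eq_mul]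
  exact ENNReal.inv_mul_cancel (riemannianVolume_pos_of_isOpen g isOpen_univ univ_nonempty).ne'
    (measure_ne_top _ _)

variable [T2Space M]

theorem exists_setLIntegral_exp_divergence_le (g : Metric n M) {X : VField n M} (hX : IsC1 X)
    {ε : ℝ} (hε : 0 < ε) : ∃ h₀ > 0, ∀ h ∈ Ioc 0 h₀, ∀ C, MeasurableSet C →
      ∫⁻ x in flow X h ⁻¹' C, ENNReal.ofReal (Real.exp (h * (divergence g X x - ε)))
        ∂(riemannianVolume g) ≤ riemannianVolume g C := by
  obtain ⟨h₂, hh₂, hcont⟩ := exists_forall_continuous_flow hX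
  -- Compactness induction ranges over arbitrary sets, so each carries a measurable superset `S`;
  -- this allows `B` to be split into measurable pieces when two patches are joined.
  have hmain : ∃ S, MeasurableSet S ∧ univ ⊆ S ∧ ∃ h₀ > 0, ∀ h ∈ Ioc 0 h₀, ∀ B ⊆ S,
      MeasurableSet B → ∫⁻ x in B, ENNReal.ofReal (Real.exp (h * (divergence g X x - ε)))
        ∂(riemannianVolume g) ≤ riemannianVolume g (flow X h '' B) := by
    refine isCompact_univ.induction_on (p := fun K => ∃ S, MeasurableSet S ∧ K ⊆ S ∧ ∃ h₀ > 0,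
      ∀ h ∈ Ioc 0 h₀, ∀ B ⊆ S,
      MeasurableSet B → ∫⁻ x in B, ENNReal.ofReal (Real.exp (h * (divergence g X x - ε)))
        ∂(riemannianVolume g) ≤ riemannianVolume g (flow X h '' B)) ?_ ?_ ?_ ?_
    · refine ⟨∅, MeasurableSet.empty, le_rfl, 1, one_pos, fun h _ B hB _ => ?_⟩
      rw [subset_empty_iff.1 hB]
      simp
    · rintro s t hst ⟨S, hS, htS, h⟩
      exact ⟨S, hS, hst.trans htS, h⟩
    · rintro s t ⟨S, hS, hsS, h₀, hh₀, H⟩ ⟨S', hS', htS', h₁, hh₁, H'⟩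
      refine ⟨S ∪ S', hS.union hS', union_subset_union hsS htS', min (min h₀ h₁) (h₂ / 2),
        by positivity, fun h hh B hB hBm => ?_⟩
      have hhh₂ : -h ∈ Ioo (-h₂) h₂ := by
        have := hh.2.trans (min_le_right _ _)
        constructor <;> linarith [hh.1]
      rw [← lintegral_inter_add_sdiff _ B hS]
      refine (add_le_add (H h ⟨hh.1, hh.2.trans ((min_le_left _ _).trans (min_le_left _ _))⟩ _
        inter_subset_right (hBm.inter hS))
        (H' h ⟨hh.1, hh.2.trans ((min_le_left _ _).trans (min_le_right _ _))⟩ (B \ S)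
          (fun x hx => (hB hx.1).resolve_left hx.2) (hBm.diff hS))).trans ?_
      have hm : MeasurableSet (flow X h '' (B \ S)) := by
        rw [image_flow_eq_preimage hX]
        exact (hcont _ hhh₂).measurable (hBm.diff hS)
      -- The flow is injective, so the images of the two disjoint pieces are disjoint and their
      -- volumes add.
      rw [← measure_union ?_ hm, ← image_union, inter_union_sdiff]
      exact (disjoint_image_iff (flow_injective hX h)).2
        (disjoint_sdiff_right.mono_left inter_subset_right)
    · intro p _
      obtain ⟨U, hU, hpU, h₀, hh₀, H⟩ := exists_volume_image_flow_bounds g hX p (half_pos hε)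
      have hV : IsOpen {x | divergence g X x < divergence g X p + ε / 2} :=
        isOpen_lt (continuous_divergence g hX) continuous_const
      refine ⟨U ∩ {x | divergence g X x < divergence g X p + ε / 2},
        mem_nhdsWithin_of_mem_nhds ((hU.inter hV).mem_nhds ⟨hpU, ?_⟩), _,
        (hU.inter hV).measurableSet, le_rfl, h₀, hh₀, fun h hh B hB hBm => ?_⟩
      · simp only [mem_ofPred_eq]; linarith
      · refine le_trans ?_ (H h hh B (hB.trans inter_subset_left) hBm).1
        rw [← setLIntegral_const]
        refine setLIntegral_mono' hBm fun x hx => ?_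
        refine ENNReal.ofReal_le_ofReal (Real.exp_le_exp.2
          (mul_le_mul_of_nonneg_left ?_ hh.1.le))
        have : divergence g X x < divergence g X p + ε / 2 := (hB hx).2
        linarith
  obtain ⟨S, -, hS, h₀, hh₀, H⟩ := hmain
  refine ⟨min h₀ (h₂ / 2), by positivity, fun h hh C hC => ?_⟩
  have hhh₂ : h ∈ Ioo (-h₂) h₂ := by
    have := hh.2.trans (min_le_right _ _)
    constructor <;> linarith [hh.1]
  exact (H h ⟨hh.1, hh.2.trans (min_le_left _ _)⟩ _ ((subset_univ _).trans hS)
    ((hcont h hhh₂).measurable hC)).trans (measure_mono (image_preimage_subset _ _))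

theorem ae_eventually_integral_divergence_le (g : Metric n M) {X : VField n M} (hX : IsC1 X)
    {ε : ℝ} (hε : 0 < ε) : ∀ᵐ x ∂(riemannianVolume g), ∀ᶠ t : ℝ in atTop,
      ∫ s in (0 : ℝ)..t, divergence g X (flow X s x) ≤ ε * t := by
  have := isLocallyFiniteMeasure_riemannianVolume g
  have hc := continuous_divergence g hX
  -- Four errors of size at most `η * t`: the loss in the volume inequality, the rate `δ = h * η` of
  -- the Birkhoff bound, the oscillation of the divergence within a step, and the incomplete last
  -- step, whose contribution is at most `C * h ≤ η * t` for large `t`.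
  set η := ε / 4 with hη
  have hη0 : 0 < η := by positivity
  obtain ⟨h₁, hh₁, H₁⟩ := exists_setLIntegral_exp_divergence_le g hX hη0
  obtain ⟨h₂, hh₂, H₂⟩ := exists_forall_abs_flow_sub_le hX hc hη0
  obtain ⟨h₃, hh₃, H₃⟩ := exists_forall_continuous_flow hX
  obtain ⟨h, hh0, hhh₁, hhh₂, hhh₃⟩ : ∃ h > 0, h ≤ h₁ ∧ h ≤ h₂ ∧ h < h₃ :=
    ⟨min h₁ (min h₂ (h₃ / 2)), by positivity, min_le_left _ _,
      (min_le_right _ _).trans (min_le_left _ _),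
      ((min_le_right _ _).trans (min_le_right _ _)).trans_lt (by linarith)⟩
  obtain ⟨C, hC0, hC⟩ : ∃ C > 0, ∀ x, |divergence g X x| ≤ C := by
    obtain ⟨C, hC⟩ := isCompact_univ.exists_bound_of_continuousOn hc.continuousOn
    exact ⟨max C 1, by positivity, fun x => (hC x (mem_univ x)).trans (le_max_left _ _)⟩
  have hae := ae_eventually_birkhoffSum_le (μ := riemannianVolume g)
    (H₃ h ⟨by linarith, hhh₃⟩).measurable
    (d := fun x => h * (divergence g X x - η)) (by fun_prop) (H₁ h ⟨hh0, hhh₁⟩)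
    (mul_pos hh0 hη0)
  filter_upwards [hae] with x hx
  have hN : Tendsto (fun t : ℝ => ⌊t / h⌋₊) atTop atTop :=
    tendsto_nat_floor_atTop.comp (tendsto_id.atTop_div_const hh0)
  filter_upwards [hN.eventually hx, eventually_ge_atTop (C * h / η), eventually_ge_atTop 0]
    with t ht htC ht0
  set N := ⌊t / h⌋₊
  have hNt : N * h ≤ t := (le_div_iff₀ hh0).1 (Nat.floor_le (by positivity))
  have htN : t ≤ N * h + h := by
    have := (div_lt_iff₀ hh0).1 (Nat.lt_floor_add_one (t / h))
    linarith
  have h1 := integral_flow_le_birkhoffSum hX hc hh0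
    (fun s hs => H₂ s ⟨hs.1, hs.2.trans hhh₂⟩) x N
  have h2 : birkhoffSum (flow X h) (fun x => h * (divergence g X x - η)) N x
      = h * birkhoffSum (flow X h) (divergence g X) N x - h * η * N := by
    simp only [birkhoffSum, ← Finset.mul_sum, Finset.sum_sub_distrib, Finset.sum_const,
      Finset.card_range, nsmul_eq_mul]
    ring
  rw [h2] at ht
  have hcf : Continuous fun s => divergence g X (flow X s x) := hc.comp (continuous_flow X x)
  have h3 : ∫ s in (N * h : ℝ)..t, divergence g X (flow X s x) ≤ C * h := by
    have := intervalIntegral.norm_integral_le_of_norm_le_const (a := (N * h : ℝ)) (b := t)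
      (f := fun s => divergence g X (flow X s x)) (C := C) fun s _ => hC _
    refine (le_abs_self _).trans (this.trans ?_)
    rw [abs_of_nonneg (by linarith)]
    gcongr
    linarith
  rw [← intervalIntegral.integral_add_adjacent_intervals (hcf.intervalIntegrable 0 (N * h))
    (hcf.intervalIntegrable _ _)]
  have h4 : C * h ≤ η * t := by rw [div_le_iff₀ hη0] at htC; linarith
  have h5 : η * (N * h) ≤ η * t := by gcongr
  have h6 : ε = 4 * η := by rw [hη]; ring
  rw [h6]
  linarith

end

end FlowDiv

end

/-! ### The set of full measure -/

theorem mainTheorem6 {M : Type*} [TopologicalSpace M]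
    [ChartedSpace (EuclideanSpace ℝ (Fin 3)) M] [IsManifold (𝓡 3) ∞ M]
    [T2Space M] [CompactSpace M] [ConnectedSpace M]
    [MeasurableSpace M] [BorelSpace M]
    (g : FlowDiv.Metric 3 M) (X : FlowDiv.VField 3 M) (hX : FlowDiv.IsC1 X) :
    ∃ L : Set M, MeasurableSet L ∧ FlowDiv.normalizedVolume g L = 1 ∧
      ∀ x ∈ L, ∀ μ ∈ FlowDiv.limitMeasures X x,
        Integrable (FlowDiv.divergence g X) (μ : Measure M) ∧
          ∫ y, FlowDiv.divergence g X y ∂(μ : Measure M) ≤ 0 := by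
  have hc := FlowDiv.continuous_divergence g hX
  -- Only the rates `1 / (j + 1)` are used, so that the exceptional set is a countable union of null
  -- sets; a measurable null superset then makes the good set Borel.
  have hae : ∀ᵐ x ∂(FlowDiv.riemannianVolume g), ∀ j : ℕ, ∀ᶠ t : ℝ in atTop,
      ∫ s in (0 : ℝ)..t, FlowDiv.divergence g X (FlowDiv.flow X s x) ≤ (1 / (j + 1 : ℝ)) * t :=
    ae_all_iff.2 fun j => FlowDiv.ae_eventually_integral_divergence_le g hX (by positivity)
  obtain ⟨S, hS, hSm, hS0⟩ := exists_measurable_superset_of_null (ae_iff.1 hae)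
  refine ⟨Sᶜ, hSm.compl,
    FlowDiv.normalizedVolume_eq_one_of_ae g (by rwa [compl_compl]) hSm.compl, fun x hx μ hμ => ?_⟩
  have hx' : ∀ j : ℕ, ∀ᶠ t : ℝ in atTop,
      ∫ s in (0 : ℝ)..t, FlowDiv.divergence g X (FlowDiv.flow X s x) ≤ (1 / (j + 1 : ℝ)) * t :=
    by_contra fun h => hx (hS h)
  refine ⟨?_, ge_of_tendsto' tendsto_one_div_add_atTop_nhds_zero_nat fun j =>
    FlowDiv.integral_le_of_mem_limitMeasures hμ hc (hx' j)⟩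
  exact (BoundedContinuousFunction.mkOfCompact ⟨_, hc⟩).integrable (μ : Measure M)
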